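/- Setting. Let $d\ge1$, $\mathsf X=\mathbb R^d$, let $\mathsf V\subset\mathbb R^d$ be closed, let $\pi$ and $\nu$ be Borel probability measures on $\mathsf X$ and $\mathsf V$, $\mu=\pi\otimes\nu$, and assume $0<m_2:=\int_{\mathsf V}v_1^2\,d\nu(v)<\infty$. Write $\|\cdot\|_2,\langle\cdot,\cdot\rangle_2$ for the norm and inner product of the real space $L^2(\mu)$, $\mu(f)=\int f\,d\mu$, and $\Pi_vf(x,v)=\int_{\mathsf V}f(x,w)\,d\nu(w)$. Assume the following. 1. $(\mathcal L,D(\mathcal L))$ is a closed operator on $L^2(\mu)$ generating a strongly continuous contraction semigroup $(P_t)_{t\ge0}$; $\mu$ is stationary for $(P_t)$; there is a core $\mathsf C$ for $\mathcal L$ which is dense in $L^2(\mu)$ and satisfies $\mathsf C\subset D(\mathcal L)\cap D(\mathcal L^*)$. Put $\mathcal S=(\mathcal L+\mathcal L^*)/2$ and $\mathcal T=(\mathcal L-\mathcal L^*)/2$ with $D(\mathcal S)=D(\mathcal T)=\mathsf C$. 2. $\Pi_v\mathsf C\subset\mathsf C$. Let $\overline{\mathcal T\Pi_v}$ be the closure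 of $\mathcal T\Pi_v$, let $G=(\mathcal T\Pi_v)^*\,\overline{\mathcal T\Pi_v}$ with its natural domain, and let $\bar{\mathcal A}$ be the (bounded, everywhere defined) closure of $\mathcal A=(m_2\mathrm{Id}+G)^{-1}(-\mathcal T\Pi_v)^*$, $D(\mathcal A)=D((\mathcal T\Pi_v)^*)$. 3. $\mathrm{Ran}(\Pi_v)\subset\mathrm{Ker}(\mathcal S^*)$, and $\Pi_v\mathcal T\Pi_vf=0$ for all $f\in\mathsf C$. 4. For some $R_0\ge1$ and all $f\in\mathsf C$, $\ |\langle\bar{\mathcal A}\mathcal T(\mathrm{Id}-\Pi_v)f,f\rangle_2+\langle\bar{\mathcal A}\mathcal Sf,f\rangle_2|\le R_0\|(\mathrm{Id}-\Pi_v)f\|_2\|\Pi_vf\|_2$. 5. $\Psi:L^2(\mu)\to[0,\infty]$ is such that $\{\Psi<\infty\}$ is dense; for every $f\in D(\mathcal L)$ there are $f_n\in\mathsf C$ with $f_n\to f$ in $L^2(\mu)$, $\limsup_n\langle-\mathcal Lf_n,f_n\rangle_2\le\langle-\mathcal Lf,f\rangle_2$ and $\limsup_n\Psi(f_n)\le\Psi(f)$;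 and $\Psi(P_tf)\le\Psi(f)$, $\Psi(e^{-tG}f)\le\Psi(f)$, $\Psi(\Pi_vf)\le\Psi(f)$ for all $f\in L^2(\mu)$, $t\ge0$. 6. For a decreasing $\alpha_1:(0,\infty)\to[1,\infty)$, $\ \|\Pi_vf-\mu(f)\|_2^2\le\alpha_1(r)\|\overline{\mathcal T\Pi_v}f\|_2^2+r\Psi(\Pi_vf)$ for all $f\in D(\overline{\mathcal T\Pi_v})$, $r>0$. 7. For some $C_{\mathrm P}>0$, $\ \|(\mathrm{Id}-\Pi_v)f\|_2^2\le C_{\mathrm P}\langle-\mathcal Sf,f\rangle_2$ for all $f\in\mathsf C$. 8. For every $f\in L^2(\mu)$ with $\Psi(f)<\infty$ there are $f_n\in D(\mathcal L)$ with $f_n\to f$ in $L^2(\mu)$ and $\limsup_n\Psi(f_n)\le\Psi(f)$. Conclusion. There are constants $c_1,c_2>0$ depending only on $m_2$ and $R_0$ such that, with $c_2'=c_2/C_{\mathrm P}$, $$\|P_tf-\mu(f)\|_2^2\le\xi(t)\left(\|f\|_2^2+\Psi(f)\right)\qquad\text{for all }t\ge0,\ f\in L^2(\mu),$$ $$\xi(t):=c_1\inf\left\{r>0:\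 c_2't\ge\alpha_1(r)^2\log\tfrac1r\right\}.$$ If $m_2\ge1$, one can take $c_2=\dfrac{1}{R_0^2\,(2+(m_2/2)^{-1/2})\,(1+m_2)^2}$. -/

import Mathlib

open MeasureTheory Filter Topology
open scoped NNReal ENNReal LinearPMap InnerProductSpace

noncomputable section

section Operators

variable {H : Type*} [NormedAddCommGroup H] [InnerProductSpace ℝ H]

/-- The value of a partially defined operator `A` at `x`. It is only ever meant for `x` in the
domain of `A`; outside it is `0`. -/
def opEval (A : H →ₗ.[ℝ] H) (x : H) : H :=
  open Classical in if h : x ∈ A.domain then A ⟨x, h⟩ else 0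

/-- The product `B A` of two unbounded operators with its natural domain
`{x ∈ D(A) : A x ∈ D(B)}`. -/
def opMul (B A : H →ₗ.[ℝ] H) : H →ₗ.[ℝ] H where
  domain := (B.domain.comap A.toFun).map A.domain.subtype
  toFun :=
    { toFun := fun x => B ⟨A ⟨x.1, by
          obtain ⟨y, -, hyx⟩ := x.2
          exact hyx ▸ y.2⟩, by
          obtain ⟨x, y, hy, hyx⟩ := x
          subst hyx
          exact hy⟩
      map_add' := fun x y => by
        rw [← LinearPMap.map_add]
        congr 1
        apply Subtype.ext
        exact A.map_add ⟨x.1, _⟩ ⟨y.1, _⟩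
      map_smul' := fun c x => by
        rw [RingHom.id_apply, ← LinearPMap.map_smul]
        congr 1
        apply Subtype.ext
        exact A.map_smul c ⟨x.1, _⟩ }

/-- A strongly continuous semigroup of contractions. -/
structure IsContractionSemigroup (P : ℝ≥0 → H →L[ℝ] H) : Prop where
  map_zero : P 0 = ContinuousLinearMap.id ℝ H
  map_add : ∀ s t, P (s + t) = (P s).comp (P t)
  norm_le_one : ∀ t, ‖P t‖ ≤ 1
  continuous : ∀ f, Continuous fun t => P t f

/-- `L` (with its domain) is the infinitesimal generator of `P`: one has `f ∈ D(L)` and `L f = g`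
if and only if `(P_t f - f) / t → g` as `t ↓ 0`. -/
def IsGeneratorOf (L : H →ₗ.[ℝ] H) (P : ℝ≥0 → H →L[ℝ] H) : Prop :=
  ∀ f g : H, (f, g) ∈ L.graph ↔
    Tendsto (fun t : ℝ≥0 => (t : ℝ)⁻¹ • (P t f - f)) (𝓝[>] 0) (𝓝 g)

variable [CompleteSpace H]

/-- The symmetric part `S = (L + L*) / 2` with domain `C`
(for `C ⊆ D(L) ∩ D(L*)`). -/
def symPart (L : H →ₗ.[ℝ] H) (C : Submodule ℝ H) : H →ₗ.[ℝ] H :=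
  ((1 / 2 : ℝ) • (L + L†)).domRestrict C

/-- The antisymmetric part `T = (L - L*) / 2` with domain `C`
(for `C ⊆ D(L) ∩ D(L*)`). -/
def antisymPart (L : H →ₗ.[ℝ] H) (C : Submodule ℝ H) : H →ₗ.[ℝ] H :=
  ((1 / 2 : ℝ) • (L - L†)).domRestrict C

/-- The operator `T Π` with domain `{f : Π f ∈ D(T)}`, where `D(T) = C`. -/
def opTPi (L : H →ₗ.[ℝ] H) (C : Submodule ℝ H) (Pr : H →ₗ[ℝ] H) : H →ₗ.[ℝ] H :=
  opMul (antisymPart L C) (Pr.toPMap ⊤)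

/-- The operator `G = (T Π)* cl(T Π)`, where `cl` denotes the closure, with its natural domain. -/
def opG (L : H →ₗ.[ℝ] H) (C : Submodule ℝ H) (Pr : H →ₗ[ℝ] H) : H →ₗ.[ℝ] H :=
  opMul (opTPi L C Pr)† (opTPi L C Pr).closure

/-- The operator `A = (m Id + G)⁻¹ (-(T Π))*`, with domain `D((T Π)*)`
(for `m > 0` the operator `m Id + G` is a bijection of `D(G)` onto the whole space). -/
def opA (L : H →ₗ.[ℝ] H) (C : Submodule ℝ H) (Pr : H →ₗ[ℝ] H) (m : ℝ) : H →ₗ.[ℝ] H :=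
  opMul ((m • (LinearMap.id : H →ₗ[ℝ] H)) +ᵥ opG L C Pr).inverse (-(opTPi L C Pr)†)

end Operators

section Velocity

variable {X V : Type*} [MeasurableSpace X] [MeasurableSpace V]

/-- Averaging over the velocity `v` maps square integrable functions to such functions. -/
theorem memLp_velocityAverage (π : Measure X) (ν : Measure V)
    [IsProbabilityMeasure π] [IsProbabilityMeasure ν] (f : Lp ℝ 2 (π.prod ν)) :
    MemLp (fun z : X × V => ∫ w, f (z.1, w) ∂ν) 2 (π.prod ν) := by
  have hsm : StronglyMeasurable (f : X × V → ℝ) := Lp.stronglyMeasurable f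
  have hsm' : StronglyMeasurable (fun x : X => ∫ w, f (x, w) ∂ν) :=
    hsm.integral_prod_right'
  have hsq : Integrable (fun z => f z ^ 2) (π.prod ν) :=
    (memLp_two_iff_integrable_sq (Lp.aestronglyMeasurable f)).1 (Lp.memLp f)
  have hbase : MemLp (fun x : X => ∫ w, f (x, w) ∂ν) 2 π := by
    rw [memLp_two_iff_integrable_sq hsm'.aestronglyMeasurable]
    refine Integrable.mono' hsq.integral_prod_left
      (hsm'.aestronglyMeasurable.pow 2) ?_
    filter_upwards [hsq.prod_right_ae] with x hx
    have hL : MemLp (fun w => f (x, w)) 2 ν :=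
      (memLp_two_iff_integrable_sq
        (hsm.comp_measurable measurable_prodMk_left).aestronglyMeasurable).2 hx
    have hv := ProbabilityTheory.variance_nonneg (fun w => f (x, w)) ν
    rw [ProbabilityTheory.variance_eq_sub hL] at hv
    rw [Real.norm_of_nonneg (sq_nonneg _)]
    simpa using hv
  exact hbase.comp_measurePreserving measurePreserving_fst

/-- The operator `Π_v` on `L²(π ⊗ ν)`, `(Π_v f)(x, v) = ∫ f(x, w) ν(dw)`. -/
def velocityAverage (π : Measure X) (ν : Measure V)
    [IsProbabilityMeasure π] [IsProbabilityMeasure ν] :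
    Lp ℝ 2 (π.prod ν) →ₗ[ℝ] Lp ℝ 2 (π.prod ν) where
  toFun f := (memLp_velocityAverage π ν f).toLp _
  map_add' f g := by
    rw [← MemLp.toLp_add]
    apply MemLp.toLp_congr
    have hf : Integrable (fun z => f z) (π.prod ν) := (Lp.memLp f).integrable one_le_two
    have hg : Integrable (fun z => g z) (π.prod ν) := (Lp.memLp g).integrable one_le_two
    have h : ∀ᵐ x ∂π, ∫ w, (f + g : Lp ℝ 2 (π.prod ν)) (x, w) ∂ν
        = ∫ w, f (x, w) ∂ν + ∫ w, g (x, w) ∂ν := by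
      filter_upwards [Measure.ae_ae_of_ae_prod (Lp.coeFn_add f g), hf.prod_right_ae,
        hg.prod_right_ae] with x hx h1 h2
      rw [← integral_add h1 h2]
      exact integral_congr_ae hx
    exact (Measure.quasiMeasurePreserving_fst (μ := π) (ν := ν)).ae h
  map_smul' c f := by
    rw [RingHom.id_apply, ← MemLp.toLp_const_smul]
    apply MemLp.toLp_congr
    have h : ∀ᵐ x ∂π, ∫ w, (c • f : Lp ℝ 2 (π.prod ν)) (x, w) ∂ν
        = c * ∫ w, f (x, w) ∂ν := by
      filter_upwards [Measure.ae_ae_of_ae_prod (Lp.coeFn_smul c f)] with x hx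
      rw [← integral_const_mul]
      exact integral_congr_ae hx
    exact (Measure.quasiMeasurePreserving_fst (μ := π) (ν := ν)).ae h

/-- The mean `μ(f) = ∫ f dμ`, as a constant function in `L²(μ)`. -/
def meanFun {E : Type*} [MeasurableSpace E] (μ : Measure E) [IsProbabilityMeasure μ]
    (f : Lp ℝ 2 μ) : Lp ℝ 2 μ :=
  Lp.const 2 μ (∫ z, f z ∂μ)

end Velocity

section Conditions

variable {X V : Type*} [MeasurableSpace X] [MeasurableSpace V]
  (π : Measure X) (ν : Measure V) [IsProbabilityMeasure π] [IsProbabilityMeasure ν]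
  (L : Lp ℝ 2 (π.prod ν) →ₗ.[ℝ] Lp ℝ 2 (π.prod ν))
  (P : ℝ≥0 → Lp ℝ 2 (π.prod ν) →L[ℝ] Lp ℝ 2 (π.prod ν))
  (C : Submodule ℝ (Lp ℝ 2 (π.prod ν)))

/-- The basic condition on the generator, the semigroup, the stationary measure and the core. -/
structure BasicCondition : Prop where
  closed : L.IsClosed
  semigroup : IsContractionSemigroup P
  generator : IsGeneratorOf L P
  stationary : ∀ t f, ∫ z, P t f z ∂(π.prod ν) = ∫ z, f z ∂(π.prod ν)
  core : L.HasCore C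
  dense : Dense (C : Set (Lp ℝ 2 (π.prod ν)))
  le_domain : C ≤ L.domain ⊓ L†.domain

/-- `Π_v C ⊆ C`. -/
def CoreInvariance : Prop :=
  ∀ f ∈ C, velocityAverage π ν f ∈ C

/-- `Ran(Π_v) ⊆ Ker(S*)`, and `Π_v T Π_v f = 0` for `f ∈ C`. -/
structure ProjectionCondition : Prop where
  range_le_ker : ∀ f, (velocityAverage π ν f, 0) ∈ (symPart L C)†.graph
  proj_T_proj : ∀ f ∈ C,
    velocityAverage π ν (opEval (opTPi L C (velocityAverage π ν)) f) = 0

/-- `|⟨cl(A) T (Id - Π_v) f, f⟩ + ⟨cl(A) S f, f⟩| ≤ R₀ ‖(Id - Π_v) f‖ ‖Π_v f‖` for `f ∈ C`. -/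
def RemainderCondition (m₂ R₀ : ℝ) : Prop :=
  ∀ f ∈ C,
    |⟪opEval (opA L C (velocityAverage π ν) m₂).closure
          (opEval (antisymPart L C) (f - velocityAverage π ν f)), f⟫_ℝ
      + ⟪opEval (opA L C (velocityAverage π ν) m₂).closure
          (opEval (symPart L C) f), f⟫_ℝ|
    ≤ R₀ * ‖f - velocityAverage π ν f‖ * ‖velocityAverage π ν f‖

/-- The conditions on the functional `Ψ`. In `heat_le`, the family `Q` is `(e^{-tG})_{t ≥ 0}`,
that is, the strongly continuous contraction semigroup with generator `-G`. -/
structure PsiCondition (Ψ : Lp ℝ 2 (π.prod ν) → ℝ≥0∞) : Prop where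
  dense_finite : Dense {f | Ψ f < ∞}
  approx : ∀ f ∈ L.domain, ∃ u : ℕ → Lp ℝ 2 (π.prod ν), (∀ n, u n ∈ C) ∧
    Tendsto u atTop (𝓝 f) ∧
    limsup (fun n => ((⟪-opEval L (u n), u n⟫_ℝ : ℝ) : EReal)) atTop
      ≤ ((⟪-opEval L f, f⟫_ℝ : ℝ) : EReal) ∧
    limsup (fun n => Ψ (u n)) atTop ≤ Ψ f
  semigroup_le : ∀ t f, Ψ (P t f) ≤ Ψ f
  heat_le : ∀ Q : ℝ≥0 → Lp ℝ 2 (π.prod ν) →L[ℝ] Lp ℝ 2 (π.prod ν),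
    IsContractionSemigroup Q → IsGeneratorOf (-opG L C (velocityAverage π ν)) Q →
    ∀ t f, Ψ (Q t f) ≤ Ψ f
  proj_le : ∀ f, Ψ (velocityAverage π ν f) ≤ Ψ f

/-- The weak Poincaré inequality
`‖Π_v f - μ(f)‖² ≤ α(r) ‖cl(T Π_v) f‖² + r Ψ(Π_v f)` for all `f ∈ D(cl(T Π_v))` and `r > 0`. -/
def WeakPoincare (Ψ : Lp ℝ 2 (π.prod ν) → ℝ≥0∞) (α : ℝ → ℝ) : Prop :=
  ∀ (f : (opTPi L C (velocityAverage π ν)).closure.domain) (r : ℝ), 0 < r →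
    ENNReal.ofReal (‖velocityAverage π ν f - meanFun (π.prod ν) f‖ ^ 2)
      ≤ ENNReal.ofReal (α r * ‖(opTPi L C (velocityAverage π ν)).closure f‖ ^ 2)
        + ENNReal.ofReal r * Ψ (velocityAverage π ν f)

/-- The strong Poincaré inequality
`‖(Id - Π_v) f‖² ≤ C_P ⟨-S f, f⟩` for all `f ∈ C`. -/
def StrongPoincare (C_P : ℝ) : Prop :=
  ∀ f ∈ C, ‖f - velocityAverage π ν f‖ ^ 2 ≤ C_P * ⟪-opEval (symPart L C) f, f⟫_ℝ

/-- Every `f ∈ L²(μ)` with `Ψ(f) < ∞` is a limit in `L²(μ)` of elements `f_n` of `D(L)` with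
`limsup Ψ(f_n) ≤ Ψ(f)`. -/
def PsiApproximation (Ψ : Lp ℝ 2 (π.prod ν) → ℝ≥0∞) : Prop :=
  ∀ f, Ψ f < ∞ → ∃ u : ℕ → Lp ℝ 2 (π.prod ν), (∀ n, u n ∈ L.domain) ∧
    Tendsto u atTop (𝓝 f) ∧ limsup (fun n => Ψ (u n)) atTop ≤ Ψ f

end Conditions

/-- The rate function `ξ(t) = c₁ inf {r > 0 : c t ≥ α(r)² log (1 / r)}`. -/
def rateFun (c₁ c : ℝ) (α : ℝ → ℝ) (t : ℝ) : ℝ :=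
  c₁ * sInf {r : ℝ | 0 < r ∧ c * t ≥ α r ^ 2 * Real.log (1 / r)}

end

/-!
The proof is a modified-norm (Dolbeault–Mouhot–Schmeiser) argument. Write `T`, `S` for the
antisymmetric and symmetric parts of `L`, `A = T Π`, `G = A* cl(A)`, and consider the bounded
operators `R = (m + G)⁻¹` and `K = cl(A) R`; the closure of `(m + G)⁻¹ (-A*)` is `-K*`. For a
centered orbit `u` one differentiates `‖u‖² / 2 - ε ⟪u, K u⟫`, where `ε` is of order
`1 / (C_P α(r))`.

* The strong Poincaré inequality controls `‖(1 - Π) u‖` by the dissipation of `‖u‖² / 2`.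
* The derivative of the correction contributes the bounded form `⟪u, G R u⟫`, up to the remainder
  `R₀ ‖(1 - Π) u‖ ‖Π u‖` (`HypocoercivitySetting.abs_inner_sub_le`) and up to `‖(1 - Π) u‖²`
  (`HypocoercivitySetting.neg_norm_sq_le_inner`).
* This form controls `‖Π u‖²` (`HypocoercivitySetting.norm_proj_sq_le`): the weak Poincaré
  inequality gives decay of `‖e^{-tG} f‖` because `Ψ` does not increase along `e^{-tG}`, and `R` is
  the Laplace transform of `e^{-tG}` (`norm_sq_le_resolvent_form`). The semigroup `e^{-tG}` is
  constructed by von Neumann's theorem on `A* cl(A)` and Yosida approximation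
  (`IsNonnegSelfAdjoint.exists_semigroup`).
* For the modified norm to be equivalent to the norm with `ε` of order `1 / C_P`, which is not small
  if `C_P` is small, one needs `‖K‖ ≤ R₀ C_P`. This holds because the remainder condition bounds
  `L* K` on the range of `1 - Π`, where `-L*` is coercive with constant `1 / C_P`
  (`HypocoercivitySetting.norm_K_le`).

All these estimates concern `f` in the domain of `L`, where those involving `L f` pass from the core
by closedness. Functions with `Ψ f < ∞` are then reached by the approximation assumption, and the
rate function is the infimum of the bounds over `r`.
-/

/-! ### Graphs, adjoints and closures of unbounded operators -/

section Graphs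

variable {H : Type*} [NormedAddCommGroup H] [InnerProductSpace ℝ H]

theorem mem_graph_opMul {B A : H →ₗ.[ℝ] H} {x z : H} :
    (x, z) ∈ (opMul B A).graph ↔ ∃ y, (x, y) ∈ A.graph ∧ (y, z) ∈ B.graph := by
  simp only [LinearPMap.mem_graph_iff]
  constructor
  · rintro ⟨⟨x', hx'⟩, rfl, hz⟩
    obtain ⟨y, hy, rfl⟩ := id hx'
    exact ⟨A y, ⟨y, rfl, rfl⟩, ⟨⟨A y, hy⟩, rfl, hz⟩⟩
  · rintro ⟨_, ⟨x', rfl, rfl⟩, ⟨y', hy', hz⟩⟩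
    have hmem : A x' ∈ B.domain := by
      rw [← hy']
      exact y'.2
    refine ⟨⟨x', ⟨x', hmem, rfl⟩⟩, rfl, ?_⟩
    rw [← hz]
    change B ⟨A ⟨x'.1, _⟩, _⟩ = B y'
    congr 1
    exact Subtype.ext hy'.symm

theorem opEval_of_mem_graph {A : H →ₗ.[ℝ] H} {x y : H} (h : (x, y) ∈ A.graph) :
    opEval A x = y := by
  obtain ⟨x', hx', hy⟩ := A.mem_graph_iff.1 h
  simp only at hx' hy
  subst hx'
  simp [opEval, hy]

theorem opEval_mem_graph {A : H →ₗ.[ℝ] H} {x : H} (h : x ∈ A.domain) :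
    (x, opEval A x) ∈ A.graph := by
  rw [opEval, dif_pos h]
  exact A.mem_graph ⟨x, h⟩

theorem mem_graph_closure {A : H →ₗ.[ℝ] H} (hA : A.IsClosable) {x y : H} :
    (x, y) ∈ A.closure.graph ↔ ∃ u v : ℕ → H, (∀ n, (u n, v n) ∈ A.graph) ∧
      Tendsto u atTop (𝓝 x) ∧ Tendsto v atTop (𝓝 y) := by
  rw [← hA.graph_closure_eq_closure_graph, ← SetLike.mem_coe, Submodule.topologicalClosure_coe,
    mem_closure_iff_seq_limit]
  constructor
  · rintro ⟨p, hp, hlim⟩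
    rw [nhds_prod_eq, tendsto_prod_iff'] at hlim
    exact ⟨fun n => (p n).1, fun n => (p n).2, hp, hlim.1, hlim.2⟩
  · rintro ⟨u, v, h, hu, hv⟩
    exact ⟨fun n => (u n, v n), h, hu.prodMk_nhds hv⟩

variable [CompleteSpace H]

theorem mem_graph_adjoint {A : H →ₗ.[ℝ] H} (hA : Dense (A.domain : Set H)) {z w : H} :
    (z, w) ∈ A†.graph ↔ ∀ x y, (x, y) ∈ A.graph → ⟪y, z⟫_ℝ = ⟪x, w⟫_ℝ := by
  rw [LinearPMap.adjoint_graph_eq_graph_adjoint hA, Submodule.mem_adjoint_iff]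
  simp only [sub_eq_zero]

theorem isClosable_of_dense_adjoint {A : H →ₗ.[ℝ] H} (hA : Dense (A.domain : Set H))
    (hA' : Dense (A†.domain : Set H)) : A.IsClosable := by
  refine ⟨A.graph.topologicalClosure.toLinearPMap, ?_⟩
  rw [Submodule.toLinearPMap_graph_eq]
  rintro ⟨x, y⟩ hx (rfl : x = 0)
  rw [← SetLike.mem_coe, Submodule.topologicalClosure_coe, mem_closure_iff_seq_limit] at hx
  obtain ⟨p, hp, hlim⟩ := hx
  rw [nhds_prod_eq, tendsto_prod_iff'] at hlim
  refine hA'.eq_zero_of_inner_left ℝ fun z hz => ?_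
  obtain ⟨w, hw⟩ := LinearPMap.mem_domain_iff.1 hz
  have h1 : Tendsto (fun n => ⟪(p n).2, z⟫_ℝ) atTop (𝓝 ⟪y, z⟫_ℝ) :=
    hlim.2.inner tendsto_const_nhds
  have h2 : Tendsto (fun n => ⟪(p n).1, w⟫_ℝ) atTop (𝓝 ⟪(0 : H), w⟫_ℝ) :=
    hlim.1.inner tendsto_const_nhds
  rw [inner_zero_left] at h2
  exact tendsto_nhds_unique h1
    (h2.congr fun n => ((mem_graph_adjoint hA).1 hw _ _ (hp n)).symm)

theorem inner_closure_adjoint {A : H →ₗ.[ℝ] H} (hA : Dense (A.domain : Set H))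
    (hc : A.IsClosable) {x y z w : H} (hxy : (x, y) ∈ A.closure.graph)
    (hzw : (z, w) ∈ A†.graph) : ⟪y, z⟫_ℝ = ⟪x, w⟫_ℝ := by
  obtain ⟨u, v, h, hu, hv⟩ := (mem_graph_closure hc).1 hxy
  have h1 : Tendsto (fun n => ⟪v n, z⟫_ℝ) atTop (𝓝 ⟪y, z⟫_ℝ) := hv.inner tendsto_const_nhds
  have h2 : Tendsto (fun n => ⟪u n, w⟫_ℝ) atTop (𝓝 ⟪x, w⟫_ℝ) := hu.inner tendsto_const_nhds
  exact tendsto_nhds_unique h1 (h2.congr fun n => ((mem_graph_adjoint hA).1 hzw _ _ (h n)).symm)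

/-- Von Neumann's theorem: if `A` is densely defined and closable, then `m + A* cl(A)` maps onto
the whole space for `m > 0`. The solution is the orthogonal projection of `(g / m, 0)` onto the
graph of `m^{-1/2} cl(A)`. -/
theorem exists_resolvent_adjoint_mul_closure {A : H →ₗ.[ℝ] H} (hA : Dense (A.domain : Set H))
    (hc : A.IsClosable) {m : ℝ} (hm : 0 < m) (g : H) :
    ∃ x y z, (x, y) ∈ A.closure.graph ∧ (y, z) ∈ A†.graph ∧ m • x + z = g := by
  set s := √m with hs
  have hs0 : s ≠ 0 := (Real.sqrt_pos.2 hm).ne'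
  have hss : s * s = m := Real.mul_self_sqrt hm.le
  let φ : WithLp 2 (H × H) →L[ℝ] H × H :=
    ((ContinuousLinearMap.id ℝ H).prodMap (s • ContinuousLinearMap.id ℝ H)).comp
      (WithLp.prodContinuousLinearEquiv 2 ℝ H H : WithLp 2 (H × H) →L[ℝ] H × H)
  let Γ : Submodule ℝ (WithLp 2 (H × H)) := A.closure.graph.comap φ.toLinearMap
  have hΓ : IsClosed (Γ : Set (WithLp 2 (H × H))) := hc.closure_isClosed.preimage φ.continuous
  have : CompleteSpace Γ := hΓ.completeSpace_coe
  have hmem : ∀ a b : H, WithLp.toLp 2 (a, b) ∈ Γ ↔ (a, s • b) ∈ A.closure.graph :=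
    fun a b => Iff.rfl
  obtain ⟨p, hp, hort⟩ : ∃ p ∈ Γ, ∀ q ∈ Γ, ⟪WithLp.toLp 2 (m⁻¹ • g, (0 : H)) - p, q⟫_ℝ = 0 :=
    ⟨Γ.starProjection (WithLp.toLp 2 (m⁻¹ • g, (0 : H))), Submodule.starProjection_apply_mem _ _,
      fun q hq => Submodule.starProjection_inner_eq_zero _ _ hq⟩
  obtain ⟨⟨x, b⟩⟩ := p
  have hxb := (hmem x b).1 hp
  refine ⟨x, s • b, g - m • x, hxb, ?_, by abel⟩
  rw [mem_graph_adjoint hA]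
  intro x' y' hxy'
  have hq : WithLp.toLp 2 (x', s⁻¹ • y') ∈ Γ := by
    rw [hmem, smul_inv_smul₀ hs0]
    exact LinearPMap.le_graph_of_le A.le_closure hxy'
  have h := hort _ hq
  rw [WithLp.prod_inner_apply] at h
  simp only [inner_sub_left, inner_smul_left, inner_smul_right, WithLp.ofLp_sub, Prod.fst_sub,
    Prod.snd_sub, inner_zero_left] at h
  rw [inner_smul_right, inner_sub_right, inner_smul_right, real_inner_comm b y',
    real_inner_comm g x', real_inner_comm x x']
  simp only [RCLike.conj_to_real] at h
  have hsi : s * (s * s⁻¹) = s := by rw [mul_inv_cancel₀ hs0, mul_one]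
  have hmi : m * m⁻¹ = 1 := mul_inv_cancel₀ hm.ne'
  linear_combination (-m) * h + (⟪g, x'⟫_ℝ) * hmi - (⟪b, y'⟫_ℝ) * hsi + (s⁻¹ * ⟪b, y'⟫_ℝ) * hss

end Graphs

/-! ### Contraction semigroups and their generators -/

section Semigroup

variable {H : Type*} [NormedAddCommGroup H] [InnerProductSpace ℝ H]
  {P : ℝ≥0 → H →L[ℝ] H} {L : H →ₗ.[ℝ] H}

namespace IsContractionSemigroup

theorem norm_apply_le (hP : IsContractionSemigroup P) (t : ℝ≥0) (f : H) : ‖P t f‖ ≤ ‖f‖ := by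
  simpa using (P t).le_of_opNorm_le (hP.norm_le_one t) f

theorem apply_add (hP : IsContractionSemigroup P) (s t : ℝ≥0) (f : H) :
    P (s + t) f = P s (P t f) := by
  rw [hP.map_add]; rfl

theorem apply_zero (hP : IsContractionSemigroup P) (f : H) : P 0 f = f := by
  rw [hP.map_zero]; rfl

theorem continuous_toNNReal (hP : IsContractionSemigroup P) (f : H) :
    Continuous fun t : ℝ => P t.toNNReal f :=
  (hP.continuous f).comp continuous_real_toNNReal

/-- Contraction semigroups have dissipative generators. -/
theorem inner_nonpos (hP : IsContractionSemigroup P) {f g : H}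
    (h : Tendsto (fun t : ℝ≥0 => (t : ℝ)⁻¹ • (P t f - f)) (𝓝[>] 0) (𝓝 g)) : ⟪g, f⟫_ℝ ≤ 0 := by
  refine le_of_tendsto (h.inner (tendsto_const_nhds (x := f))) (Eventually.of_forall fun t => ?_)
  rw [inner_smul_left, inner_sub_left, real_inner_self_eq_norm_sq]
  refine mul_nonpos_of_nonneg_of_nonpos (by simp) ?_
  have h1 := real_inner_le_norm (P t f) f
  have h2 := mul_le_mul_of_nonneg_right (hP.norm_apply_le t f) (norm_nonneg f)
  nlinarith

end IsContractionSemigroup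

namespace IsGeneratorOf

theorem inner_nonpos (hL : IsGeneratorOf L P) (hP : IsContractionSemigroup P) {f g : H}
    (h : (f, g) ∈ L.graph) : ⟪g, f⟫_ℝ ≤ 0 :=
  hP.inner_nonpos ((hL f g).1 h)

theorem map_mem_graph (hL : IsGeneratorOf L P) (hP : IsContractionSemigroup P) {f g : H}
    (h : (f, g) ∈ L.graph) (t : ℝ≥0) : (P t f, P t g) ∈ L.graph := by
  rw [hL]
  refine (((P t).continuous.tendsto g).comp ((hL f g).1 h)).congr fun s => ?_
  simp only [Function.comp_apply, map_smul, map_sub]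
  rw [← hP.apply_add, ← hP.apply_add, add_comm]

/-- Orbits starting in the domain of the generator are differentiable from the right. -/
theorem hasDerivWithinAt (hL : IsGeneratorOf L P) (hP : IsContractionSemigroup P) {f g : H}
    (h : (f, g) ∈ L.graph) {t : ℝ} (ht : 0 ≤ t) :
    HasDerivWithinAt (fun s : ℝ => P s.toNNReal f) (P t.toNNReal g) (Set.Ici t) t := by
  rw [← hasDerivWithinAt_Ioi_iff_Ici, hasDerivWithinAt_iff_tendsto_slope' (by simp)]
  have hshift : Tendsto (fun s : ℝ => (s - t).toNNReal) (𝓝[>] t) (𝓝[>] 0) := by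
    refine tendsto_nhdsWithin_iff.2 ⟨?_, ?_⟩
    · have : Continuous fun s : ℝ => (s - t).toNNReal := by fun_prop
      simpa using (this.tendsto t).mono_left nhdsWithin_le_nhds
    · filter_upwards [self_mem_nhdsWithin] with s hs
      simpa using hs
  have h1 := ((P t.toNNReal).continuous.tendsto g).comp (((hL f g).1 h).comp hshift)
  refine h1.congr' ?_
  filter_upwards [self_mem_nhdsWithin] with s hs
  have hs' : 0 ≤ s - t := sub_nonneg.2 (le_of_lt hs)
  have hadd : s.toNNReal = t.toNNReal + (s - t).toNNReal := by
    rw [← Real.toNNReal_add ht hs', add_sub_cancel]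
  simp only [Function.comp_apply, slope, vsub_eq_sub, map_smul, map_sub]
  rw [Real.coe_toNNReal _ hs', hadd, hP.apply_add]

variable [CompleteSpace H]

/-- The resolvent of the generator of a contraction semigroup is everywhere defined: the range of
`n - L` is closed since `L` is closed and dissipative, and a vector `w` orthogonal to it is `0`,
since `t ↦ exp (-n t) ⟪P t f, w⟫` is constant and tends to `0` for every `f` in the domain. -/
theorem exists_resolvent (hL : IsGeneratorOf L P) (hP : IsContractionSemigroup P)
    (hc : L.IsClosed) (hd : Dense (L.domain : Set H)) {n : ℝ} (hn : 0 < n) (h : H) :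
    ∃ f g, (f, g) ∈ L.graph ∧ n • f - g = h := by
  have : CompleteSpace L.graph := IsClosed.completeSpace_coe (hs := hc)
  let Φ : L.graph →L[ℝ] H :=
    (n • ContinuousLinearMap.fst ℝ H H - ContinuousLinearMap.snd ℝ H H).comp L.graph.subtypeL
  have hΦ : ∀ p : L.graph, Φ p = n • p.1.1 - p.1.2 := fun p => rfl
  have hbound : ∀ p : L.graph, ‖p‖ ≤ (1 / n + 2).toNNReal * ‖Φ p‖ := by
    intro p
    obtain ⟨⟨f, g⟩, hp⟩ := p
    have hdis := hL.inner_nonpos hP hp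
    have h1 : n * ‖f‖ ≤ ‖n • f - g‖ := by
      have h2 := real_inner_le_norm (n • f - g) f
      rw [inner_sub_left, inner_smul_left, real_inner_self_eq_norm_sq] at h2
      simp only [RCLike.conj_to_real] at h2
      by_cases hf : ‖f‖ = 0
      · simp [hf]
      · have : 0 < ‖f‖ := lt_of_le_of_ne (norm_nonneg f) (Ne.symm hf)
        refine le_of_mul_le_mul_right ?_ this
        nlinarith
    have h3 : ‖g‖ ≤ 2 * ‖n • f - g‖ := by
      have h4 : ‖n • f - (n • f - g)‖ ≤ ‖n • f‖ + ‖n • f - g‖ := norm_sub_le _ _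
      rw [sub_sub_cancel, norm_smul, Real.norm_of_nonneg hn.le] at h4
      linarith
    have h5 : ‖f‖ ≤ 1 / n * ‖n • f - g‖ := by
      rw [one_div, ← div_eq_inv_mul, le_div_iff₀ hn]
      linarith
    rw [hΦ, Real.coe_toNNReal _ (by positivity)]
    have h6 : 0 ≤ 1 / n * ‖n • f - g‖ := by positivity
    have h7 := norm_nonneg (n • f - g)
    change max ‖f‖ ‖g‖ ≤ _
    rw [add_mul]
    exact max_le (by linarith) (by linarith)
  have hcl : IsClosed (Set.range Φ) :=
    (Φ.antilipschitz_of_bound hbound).isClosed_range Φ.uniformContinuous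
  have htop : Φ.range = ⊤ := by
    have hcomp : CompleteSpace Φ.range := by
      refine IsClosed.completeSpace_coe (hs := ?_)
      exact hcl
    rw [← Submodule.orthogonal_eq_bot_iff, Submodule.eq_bot_iff]
    intro w hw
    refine hd.eq_zero_of_inner_right ℝ fun f hf => ?_
    obtain ⟨g, hfg⟩ := LinearPMap.mem_domain_iff.1 hf
    have hort : ∀ t : ℝ, ⟪P t.toNNReal g, w⟫_ℝ = n * ⟪P t.toNNReal f, w⟫_ℝ := by
      intro t
      have h1 := (Submodule.mem_orthogonal _ _).1 hw (Φ ⟨_, hL.map_mem_graph hP hfg t.toNNReal⟩)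
        ⟨_, rfl⟩
      rw [hΦ, inner_sub_left, inner_smul_left, RCLike.conj_to_real] at h1
      linarith
    have hconst : ∀ t : ℝ, 0 ≤ t → Real.exp (-(n * t)) * ⟪P t.toNNReal f, w⟫_ℝ = ⟪f, w⟫_ℝ := by
      intro t ht
      have h2 := constant_of_has_deriv_right_zero
        (f := fun t : ℝ => Real.exp (-(n * t)) * ⟪P t.toNNReal f, w⟫_ℝ) (a := 0) (b := t)
        (Continuous.continuousOn <| by
          have := (hP.continuous_toNNReal f).inner (continuous_const (y := w)) (𝕜 := ℝ)
          fun_prop)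
        (fun s hs => by
          have hd1 : HasDerivWithinAt (fun s : ℝ => Real.exp (-(n * s)))
              (Real.exp (-(n * s)) * (-(n * 1))) (Set.Ici s) s :=
            (((hasDerivAt_id s).const_mul n).neg.exp).hasDerivWithinAt
          have hd2 := (hL.hasDerivWithinAt hP hfg hs.1).inner ℝ
            (hasDerivWithinAt_const s (Set.Ici s) w)
          refine (hd1.mul hd2).congr_deriv ?_
          rw [hort, inner_zero_right]
          ring) t ⟨ht, le_rfl⟩
      simpa [hP.apply_zero] using h2
    have hlim : Tendsto (fun t : ℝ => Real.exp (-(n * t)) * (‖f‖ * ‖w‖)) atTop (𝓝 0) := by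
      have : Tendsto (fun t : ℝ => Real.exp (-(n * t))) atTop (𝓝 0) :=
        Real.tendsto_exp_neg_atTop_nhds_zero.comp (tendsto_id.const_mul_atTop hn)
      simpa using this.mul_const (‖f‖ * ‖w‖)
    have hle : |⟪f, w⟫_ℝ| ≤ 0 := by
      refine ge_of_tendsto hlim ?_
      filter_upwards [eventually_ge_atTop 0] with t ht
      rw [← hconst t ht, abs_mul, abs_of_pos (Real.exp_pos _)]
      gcongr
      exact (abs_real_inner_le_norm _ _).trans
        (mul_le_mul_of_nonneg_right (hP.norm_apply_le _ f) (norm_nonneg w))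
    exact abs_eq_zero.1 (le_antisymm hle (abs_nonneg _))
  have hh : h ∈ Φ.range := htop ▸ Submodule.mem_top
  obtain ⟨p, hp⟩ := hh
  exact ⟨p.1.1, p.1.2, p.2, hp⟩

end IsGeneratorOf

end Semigroup

/-! ### Semigroups of bounded operators -/

section BoundedHeat

variable {H : Type*} [NormedAddCommGroup H] [InnerProductSpace ℝ H]

/-- A sequence of equibounded operators that is strongly Cauchy on a dense set is strongly
Cauchy. -/
theorem cauchySeq_of_dense {T : ℕ → H →L[ℝ] H} {c : ℝ} (hc : 0 < c)
    (hT : ∀ n f, ‖T n f‖ ≤ c * ‖f‖) {D : Set H} (hD : Dense D)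
    (hcau : ∀ f ∈ D, CauchySeq fun n => T n f) (f : H) : CauchySeq fun n => T n f := by
  rw [Metric.cauchySeq_iff']
  intro ε hε
  obtain ⟨g, hg, hfg⟩ := hD.exists_dist_lt f (show 0 < ε / (3 * c) by positivity)
  obtain ⟨N, hN⟩ := (Metric.cauchySeq_iff'.1 (hcau g hg)) (ε / 3) (by positivity)
  refine ⟨N, fun n hn => ?_⟩
  have hb : ∀ n, dist (T n f) (T n g) < ε / 3 := by
    intro n
    rw [dist_eq_norm, ← map_sub]
    refine (hT n _).trans_lt ?_
    rw [dist_eq_norm, lt_div_iff₀ (by positivity)] at hfg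
    linarith
  have h1 := dist_triangle4 (T n f) (T n g) (T N g) (T N f)
  have h2 := hb n
  have h3 := hb N
  rw [dist_comm] at h3
  linarith [hN n hn]

/-- The semigroup `e^{-tY}` of a bounded operator `Y`. -/
noncomputable def expHeat (Y : H →L[ℝ] H) (t : ℝ) : H →L[ℝ] H :=
  NormedSpace.exp (t • (-Y))

variable {Y : H →L[ℝ] H}

theorem expHeat_zero (f : H) : expHeat Y 0 f = f := by
  simp [expHeat]

theorem expHeat_comm (t : ℝ) (f : H) : Y (expHeat Y t f) = expHeat Y t (Y f) := by
  let _ : NormedAlgebra ℚ (H →L[ℝ] H) := NormedAlgebra.restrictScalars ℚ ℝ _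
  have h : Commute Y (NormedSpace.exp (t • (-Y))) :=
    (((Commute.refl Y).neg_right).smul_right t).exp_right
  exact congrArg (fun T : H →L[ℝ] H => T f) h.eq

variable [CompleteSpace H]

theorem expHeat_add (s t : ℝ) (f : H) : expHeat Y (s + t) f = expHeat Y s (expHeat Y t f) := by
  have hc : Commute (s • (-Y)) (t • (-Y)) := ((Commute.refl (-Y)).smul_right t).smul_left s
  let _ : NormedAlgebra ℚ (H →L[ℝ] H) := NormedAlgebra.restrictScalars ℚ ℝ _
  rw [expHeat, add_smul, NormedSpace.exp_add_of_commute hc]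
  rfl

theorem hasDerivAt_expHeat (t : ℝ) (f : H) :
    HasDerivAt (fun s => expHeat Y s f) (-(Y (expHeat Y t f))) t := by
  have h := hasDerivAt_exp_smul_const' (𝕂 := ℝ) (-Y) t
  have h2 := h.clm_apply (hasDerivAt_const t f)
  refine h2.congr_deriv ?_
  simp [expHeat]

theorem expHeat_symm (hsym : ∀ f g, ⟪Y f, g⟫_ℝ = ⟪f, Y g⟫_ℝ) (t : ℝ) (f g : H) :
    ⟪expHeat Y t f, g⟫_ℝ = ⟪f, expHeat Y t g⟫_ℝ := by
  let _ : NormedAlgebra ℚ (H →L[ℝ] H) := NormedAlgebra.restrictScalars ℚ ℝ _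
  have hY : IsSelfAdjoint Y :=
    (ContinuousLinearMap.isSelfAdjoint_iff_isSymmetric).2 hsym
  have h : IsSelfAdjoint (expHeat Y t) := ((IsSelfAdjoint.all t).smul hY.neg).exp
  exact (ContinuousLinearMap.isSelfAdjoint_iff_isSymmetric.1 h) f g

theorem continuous_expHeat (f : H) : Continuous fun t => expHeat Y t f :=
  continuous_iff_continuousAt.2 fun t => (hasDerivAt_expHeat t f).continuousAt

theorem norm_expHeat_le (hpos : ∀ f, 0 ≤ ⟪Y f, f⟫_ℝ) {t : ℝ} (ht : 0 ≤ t) (f : H) :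
    ‖expHeat Y t f‖ ≤ ‖f‖ := by
  have hanti : Antitone fun s => ‖expHeat Y s f‖ ^ 2 := by
    refine antitone_of_hasDerivAt_nonpos (fun s => (hasDerivAt_expHeat s f).norm_sq) fun s => ?_
    have := hpos (expHeat Y s f)
    rw [inner_neg_right, real_inner_comm]
    simp only [Pi.zero_apply]
    linarith
  have := hanti ht
  simp only [expHeat_zero] at this
  exact (sq_le_sq₀ (norm_nonneg _) (norm_nonneg _)).1 this

/-- The smoothing estimate `‖Y e^{-tY}‖ ≤ 1 / t`: the quantity
`‖u‖² + 2 t ⟪Y u, u⟫ + 2 t² ‖Y u‖²` is nonincreasing along `u = e^{-tY} f`. -/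
theorem mul_norm_expHeat_le (hsym : ∀ f g, ⟪Y f, g⟫_ℝ = ⟪f, Y g⟫_ℝ)
    (hpos : ∀ f, 0 ≤ ⟪Y f, f⟫_ℝ) {t : ℝ} (ht : 0 ≤ t) (f : H) :
    t * ‖Y (expHeat Y t f)‖ ≤ ‖f‖ := by
  set φ : ℝ → ℝ := fun s => ‖expHeat Y s f‖ ^ 2 +
    (2 * s) * ⟪Y (expHeat Y s f), expHeat Y s f⟫_ℝ + (2 * s ^ 2) * ‖Y (expHeat Y s f)‖ ^ 2 with hφ
  have hder : ∀ s, HasDerivAt φ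
      (-(4 * s ^ 2 * ⟪Y (Y (expHeat Y s f)), Y (expHeat Y s f)⟫_ℝ)) s := by
    intro s
    have hu := hasDerivAt_expHeat (Y := Y) s f
    have hYu : HasDerivAt (fun r => Y (expHeat Y r f)) (Y (-(Y (expHeat Y s f)))) s :=
      Y.hasFDerivAt.comp_hasDerivAt s hu
    have h1 : HasDerivAt (fun r : ℝ => 2 * r) 2 s := by
      simpa using (hasDerivAt_id s).const_mul 2
    have h2 : HasDerivAt (fun r : ℝ => 2 * r ^ 2) (2 * (2 * s)) s := by
      simpa using (hasDerivAt_pow 2 s).const_mul 2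
    refine ((hu.norm_sq.add (h1.mul (hYu.inner ℝ hu))).add (h2.mul hYu.norm_sq)).congr_deriv ?_
    simp only [map_neg, inner_neg_left, inner_neg_right, real_inner_self_eq_norm_sq]
    rw [hsym (Y (expHeat Y s f)), real_inner_self_eq_norm_sq,
      real_inner_comm (Y (expHeat Y s f)) (expHeat Y s f),
      real_inner_comm (Y (Y (expHeat Y s f)))]
    ring
  have hanti : Antitone φ := by
    refine antitone_of_hasDerivAt_nonpos hder fun s => ?_
    have := hpos (Y (expHeat Y s f))
    simp only [Pi.zero_apply]
    have := mul_nonneg (mul_nonneg (by norm_num : (0 : ℝ) ≤ 4) (sq_nonneg s)) this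
    linarith
  have h := hanti ht
  simp only [hφ, expHeat_zero] at h
  have hp := mul_nonneg (mul_nonneg zero_le_two ht) (hpos (expHeat Y t f))
  have h3 : (t * ‖Y (expHeat Y t f)‖) ^ 2 ≤ ‖f‖ ^ 2 := by
    nlinarith [sq_nonneg ‖expHeat Y t f‖, sq_nonneg (t * ‖Y (expHeat Y t f)‖)]
  exact (sq_le_sq₀ (by positivity) (norm_nonneg _)).1 h3

/-- Kato's estimate for two Yosida approximations `Y` and `Z` of the same monotone operator, with
parameters `a` and `b`: the hypothesis `hmon` is the monotonicity of this operator between the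
points `f - a Y f` and `g - b Z g` of its domain, where its values are `Y f` and `Z g`. -/
theorem norm_expHeat_sub_sq_le {Z : H →L[ℝ] H} (hpY : ∀ f, 0 ≤ ⟪Y f, f⟫_ℝ)
    (hpZ : ∀ f, 0 ≤ ⟪Z f, f⟫_ℝ) {a b c : ℝ} (ha : 0 ≤ a) (hb : 0 ≤ b)
    (hmon : ∀ f g, 0 ≤ ⟪Y f - Z g, (f - a • Y f) - (g - b • Z g)⟫_ℝ) {f : H}
    (hY : ‖Y f‖ ≤ c) (hZ : ‖Z f‖ ≤ c) {t : ℝ} (ht : 0 ≤ t) :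
    ‖expHeat Y t f - expHeat Z t f‖ ^ 2 ≤ 2 * (a + b) * c ^ 2 * t := by
  have hder : ∀ s, HasDerivAt (fun r => ‖expHeat Y r f - expHeat Z r f‖ ^ 2)
      (2 * ⟪expHeat Y s f - expHeat Z s f, -(Y (expHeat Y s f)) - -(Z (expHeat Z s f))⟫_ℝ) s :=
    fun s => ((hasDerivAt_expHeat s f).sub (hasDerivAt_expHeat s f)).norm_sq
  refine image_le_of_deriv_right_le_deriv_boundary
    (f := fun r => ‖expHeat Y r f - expHeat Z r f‖ ^ 2)
    (B := fun r => 2 * (a + b) * c ^ 2 * r) (B' := fun _ => 2 * (a + b) * c ^ 2)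
    (a := 0) (b := t)
    (fun s _ => (hder s).continuousAt.continuousWithinAt)
    (fun s _ => (hder s).hasDerivWithinAt) (by simp [expHeat_zero]) (by fun_prop)
    (fun s _ => by
      simpa using ((hasDerivAt_id s).const_mul (2 * (a + b) * c ^ 2)).hasDerivWithinAt)
    (fun s hs => ?_) ⟨ht, le_rfl⟩
  set u := expHeat Y s f
  set v := expHeat Z s f
  have hp : ‖Y u‖ ≤ c := by
    rw [expHeat_comm]; exact (norm_expHeat_le hpY hs.1 _).trans hY
  have hq : ‖Z v‖ ≤ c := by
    rw [expHeat_comm]; exact (norm_expHeat_le hpZ hs.1 _).trans hZ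
  have h1 := hmon u v
  have h2 := real_inner_le_norm (Y u) (Z v)
  have h3 : ‖Y u‖ * ‖Z v‖ ≤ c * c := mul_le_mul hp hq (norm_nonneg _) ((norm_nonneg _).trans hp)
  have h4 : ⟪Y u - Z v, (u - a • Y u) - (v - b • Z v)⟫_ℝ
      = ⟪u - v, Y u - Z v⟫_ℝ - a * ‖Y u‖ ^ 2 - b * ‖Z v‖ ^ 2 + (a + b) * ⟪Y u, Z v⟫_ℝ := by
    simp only [inner_sub_left, inner_sub_right, inner_smul_right, real_inner_self_eq_norm_sq]
    rw [real_inner_comm (Y u) (Z v), real_inner_comm (Y u) u, real_inner_comm (Y u) v,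
      real_inner_comm (Z v) u, real_inner_comm (Z v) v]
    ring
  have h5 : ⟪u - v, -(Y u) - -(Z v)⟫_ℝ = -⟪u - v, Y u - Z v⟫_ℝ := by
    rw [← inner_neg_right]; congr 1; abel
  have h6 : (a + b) * ⟪Y u, Z v⟫_ℝ ≤ (a + b) * (c * c) :=
    mul_le_mul_of_nonneg_left (h2.trans h3) (add_nonneg ha hb)
  have h7 : 0 ≤ a * ‖Y u‖ ^ 2 := by positivity
  have h8 : 0 ≤ b * ‖Z v‖ ^ 2 := by positivity
  rw [h5]
  nlinarith

end BoundedHeat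

/-! ### Nonnegative self-adjoint operators generate contraction semigroups -/

section HilleYosida

variable {H : Type*} [NormedAddCommGroup H] [InnerProductSpace ℝ H]

theorem mem_graph_neg {G : H →ₗ.[ℝ] H} {f g : H} :
    (f, g) ∈ (-G).graph ↔ (f, -g) ∈ G.graph := by
  simp only [LinearPMap.mem_graph_iff, LinearPMap.neg_apply, LinearPMap.neg_domain]
  simp only [neg_eq_iff_eq_neg]

/-- `G` is symmetric and nonnegative, and `m + G` maps onto the whole space for all `m > 0`;
equivalently, `G` is self-adjoint and nonnegative. -/
structure IsNonnegSelfAdjoint (G : H →ₗ.[ℝ] H) : Prop where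
  symm : ∀ x z x' z', (x, z) ∈ G.graph → (x', z') ∈ G.graph → ⟪z, x'⟫_ℝ = ⟪x, z'⟫_ℝ
  nonneg : ∀ x z, (x, z) ∈ G.graph → 0 ≤ ⟪z, x⟫_ℝ
  surj : ∀ m : ℝ, 0 < m → ∀ g, ∃ x z, (x, z) ∈ G.graph ∧ m • x + z = g

namespace IsNonnegSelfAdjoint

variable {G : H →ₗ.[ℝ] H}

theorem eq_zero_of_mem_graph (hG : IsNonnegSelfAdjoint G) {m : ℝ} (hm : 0 < m) {x : H}
    (h : (x, -(m • x)) ∈ G.graph) : x = 0 := by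
  have := hG.nonneg _ _ h
  rw [inner_neg_left, inner_smul_left, RCLike.conj_to_real, real_inner_self_eq_norm_sq] at this
  have h2 : ‖x‖ ^ 2 ≤ 0 := by
    by_contra hcon
    push Not at hcon
    nlinarith
  exact norm_eq_zero.1 (pow_eq_zero_iff two_ne_zero |>.1 (le_antisymm h2 (sq_nonneg _)))

theorem eq_of_mem_graph (hG : IsNonnegSelfAdjoint G) {m : ℝ} (hm : 0 < m) {x z x' z' : H}
    (h : (x, z) ∈ G.graph) (h' : (x', z') ∈ G.graph) (he : m • x + z = m • x' + z') : x = x' := by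
  refine sub_eq_zero.1 (hG.eq_zero_of_mem_graph hm ?_)
  have h1 : (x - x', z - z') ∈ G.graph := G.graph.sub_mem h h'
  have h2 : z - z' = -(m • (x - x')) := by
    rw [smul_sub, ← sub_eq_zero]
    rw [← sub_eq_zero] at he
    rw [← he]
    abel
  rwa [h2] at h1

/-- The resolvent `(m + G)⁻¹` as a bounded operator. -/
theorem exists_resolvent (hG : IsNonnegSelfAdjoint G) {m : ℝ} (hm : 0 < m) :
    ∃ R : H →L[ℝ] H, ∀ g, (R g, g - m • R g) ∈ G.graph := by
  choose x z hxz hsum using hG.surj m hm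
  have hz : ∀ g, z g = g - m • x g := fun g => by rw [eq_sub_iff_add_eq', hsum]
  have hbound : ∀ g, ‖x g‖ ≤ m⁻¹ * ‖g‖ := by
    intro g
    have h1 := hG.nonneg _ _ (hxz g)
    have h2 := real_inner_le_norm g (x g)
    rw [hz, inner_sub_left, inner_smul_left, RCLike.conj_to_real,
      real_inner_self_eq_norm_sq] at h1
    rw [← div_eq_inv_mul, le_div_iff₀ hm]
    rcases (norm_nonneg (x g)).eq_or_lt with h0 | h0
    · rw [← h0]; simp
    · refine le_of_mul_le_mul_right ?_ h0
      nlinarith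
  let R₀ : H →ₗ[ℝ] H :=
    { toFun := x
      map_add' := fun g h => by
        refine hG.eq_of_mem_graph hm (hxz _) (G.graph.add_mem (hxz g) (hxz h)) ?_
        rw [hsum, smul_add, add_add_add_comm, hsum, hsum]
      map_smul' := fun c g => by
        refine hG.eq_of_mem_graph hm (hxz _) (G.graph.smul_mem c (hxz g)) ?_
        change _ = m • c • x g + c • z g
        rw [hsum, smul_comm m c, ← smul_add, hsum] }
  refine ⟨R₀.mkContinuous m⁻¹ hbound, fun g => ?_⟩
  have h := hxz g
  rw [hz] at h
  exact h

/-- The Yosida approximation `Y = m (1 - m (m + G)⁻¹)` of `G`, given with the parameter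
`a = 1 / m`. -/
theorem exists_yosida (hG : IsNonnegSelfAdjoint G) {a : ℝ} (ha : 0 < a) :
    ∃ Y : H →L[ℝ] H, ∀ g, (g - a • Y g, Y g) ∈ G.graph := by
  obtain ⟨R, hR⟩ := hG.exists_resolvent (inv_pos.2 ha)
  refine ⟨a⁻¹ • (ContinuousLinearMap.id ℝ H - a⁻¹ • R), fun g => ?_⟩
  have h := G.graph.smul_mem a⁻¹ (hR g)
  convert h using 1
  ext
  · simp [smul_smul, mul_inv_cancel₀ ha.ne']
  · simp

section Yosida

variable {a : ℝ} {Y : H →L[ℝ] H}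

theorem yosida_symm (hG : IsNonnegSelfAdjoint G) (hY : ∀ g, (g - a • Y g, Y g) ∈ G.graph)
    (f g : H) : ⟪Y f, g⟫_ℝ = ⟪f, Y g⟫_ℝ := by
  have h := hG.symm _ _ _ _ (hY f) (hY g)
  simp only [inner_sub_left, inner_sub_right, inner_smul_left, inner_smul_right,
    RCLike.conj_to_real] at h
  linarith

theorem yosida_nonneg (hG : IsNonnegSelfAdjoint G) (ha : 0 ≤ a)
    (hY : ∀ g, (g - a • Y g, Y g) ∈ G.graph) (f : H) : 0 ≤ ⟪Y f, f⟫_ℝ := by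
  have h := hG.nonneg _ _ (hY f)
  simp only [inner_sub_right, inner_smul_right, real_inner_self_eq_norm_sq] at h
  nlinarith [mul_nonneg ha (sq_nonneg ‖Y f‖)]

theorem norm_yosida_le (hG : IsNonnegSelfAdjoint G) (ha : 0 < a)
    (hY : ∀ g, (g - a • Y g, Y g) ∈ G.graph) {f z : H} (hf : (f, z) ∈ G.graph) :
    ‖Y f‖ ≤ ‖z‖ := by
  have h := hG.nonneg _ _ (G.graph.sub_mem hf (hY f))
  simp only [sub_sub_cancel, inner_smul_right, inner_sub_left,
    real_inner_self_eq_norm_sq] at h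
  have h1 := real_inner_le_norm z (Y f)
  have h2 : 0 ≤ ⟪z, Y f⟫_ℝ - ‖Y f‖ ^ 2 := nonneg_of_mul_nonneg_right h ha
  rcases (norm_nonneg (Y f)).eq_or_lt with h0 | h0
  · rw [← h0]; exact norm_nonneg z
  · refine le_of_mul_le_mul_right ?_ h0
    nlinarith

/-- On the domain of `G` the Yosida approximation is `(1 + a G)⁻¹ G`. -/
theorem yosida_eq (hG : IsNonnegSelfAdjoint G) (ha : 0 < a)
    (hY : ∀ g, (g - a • Y g, Y g) ∈ G.graph) {f z : H} (hf : (f, z) ∈ G.graph) :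
    Y f = z - a • Y z := by
  have h1 := G.graph.smul_mem a⁻¹ (G.graph.sub_mem hf (hY f))
  have h2 : a⁻¹ • ((f, z) - (f - a • Y f, Y f)) = (Y f, a⁻¹ • (z - Y f)) := by
    ext
    · simp [smul_smul, inv_mul_cancel₀ ha.ne']
    · simp
  rw [h2] at h1
  refine hG.eq_of_mem_graph (inv_pos.2 ha) h1 (hY z) ?_
  rw [smul_sub, smul_sub, smul_smul, inv_mul_cancel₀ ha.ne', one_smul]
  abel

end Yosida

theorem dense_domain [CompleteSpace H] (hG : IsNonnegSelfAdjoint G) :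
    Dense (G.domain : Set H) := by
  rw [Submodule.dense_iff_topologicalClosure_eq_top, Submodule.topologicalClosure_eq_top_iff,
    Submodule.eq_bot_iff]
  intro w hw
  obtain ⟨x, z, hxz, hsum⟩ := hG.surj 1 one_pos w
  have h0 := (Submodule.mem_orthogonal' _ _).1 hw x (LinearPMap.mem_domain_of_mem_graph hxz)
  have h1 := hG.nonneg _ _ hxz
  rw [← hsum, one_smul, inner_add_left, real_inner_self_eq_norm_sq] at h0
  have h2 : ‖x‖ ^ 2 = 0 := by nlinarith [sq_nonneg ‖x‖]
  have hx : x = 0 := by simpa using h2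
  subst hx
  rw [← hsum, G.graph_fst_eq_zero_snd hxz rfl]
  simp

theorem isClosed (hG : IsNonnegSelfAdjoint G) : G.IsClosed := by
  obtain ⟨R, hR⟩ := hG.exists_resolvent one_pos
  have : (G.graph : Set (H × H)) = {p | R (p.1 + p.2) = p.1} := by
    ext ⟨x, z⟩
    constructor
    · intro h
      exact hG.eq_of_mem_graph one_pos (hR _) h (by simp)
    · intro h
      have h1 := hR (x + z)
      rw [show R (x + z) = x from h] at h1
      simpa using h1
  rw [LinearPMap.IsClosed, this]
  exact isClosed_eq (by fun_prop) continuous_fst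

variable [CompleteSpace H]

/-- A nonnegative self-adjoint operator generates a contraction semigroup, whose members are
symmetric and map into the domain at positive times. It is the strong limit of the
semigroups of the Yosida approximations. -/
theorem exists_semigroup (hG : IsNonnegSelfAdjoint G) :
    ∃ Q : ℝ≥0 → H →L[ℝ] H, IsContractionSemigroup Q ∧ IsGeneratorOf (-G) Q ∧
      (∀ t f g, ⟪Q t f, g⟫_ℝ = ⟪f, Q t g⟫_ℝ) ∧ ∀ t, 0 < t → ∀ f, Q t f ∈ G.domain := by
  let a : ℕ → ℝ := fun n => 1 / ((n : ℝ) + 1)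
  have ha : ∀ n, 0 < a n := fun n => by positivity
  have ha0 : Tendsto a atTop (𝓝 0) := tendsto_one_div_add_atTop_nhds_zero_nat
  choose Y hY using fun n => hG.exists_yosida (ha n)
  have hsym : ∀ n f g, ⟪Y n f, g⟫_ℝ = ⟪f, Y n g⟫_ℝ := fun n => hG.yosida_symm (hY n)
  have hpos : ∀ n f, 0 ≤ ⟪Y n f, f⟫_ℝ := fun n => hG.yosida_nonneg (ha n).le (hY n)
  have hE : ∀ n (t : ℝ≥0) f, ‖expHeat (Y n) t f‖ ≤ ‖f‖ := fun n t =>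
    norm_expHeat_le (hpos n) t.2
  have hD := hG.dense_domain
  -- strong convergence of the approximating semigroups
  have hcauD : ∀ t : ℝ≥0, ∀ f ∈ (G.domain : Set H), CauchySeq fun n => expHeat (Y n) t f := by
    intro t f hf
    obtain ⟨z, hz⟩ := LinearPMap.mem_domain_iff.1 hf
    rw [Metric.cauchySeq_iff']
    intro ε hε
    have hlim : Tendsto (fun n => 2 * (a n + a n) * ‖z‖ ^ 2 * (t : ℝ)) atTop (𝓝 0) := by
      simpa using (((ha0.add ha0).const_mul 2).mul_const (‖z‖ ^ 2)).mul_const (t : ℝ)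
    obtain ⟨N, hN⟩ := (hlim.eventually (gt_mem_nhds (show 0 < ε ^ 2 by positivity))).exists
    refine ⟨N, fun n hn => ?_⟩
    have h := norm_expHeat_sub_sq_le (hpos n) (hpos N) (ha n).le (ha N).le
      (fun f g => hG.nonneg _ _ (G.graph.sub_mem (hY n f) (hY N g)))
      (hG.norm_yosida_le (ha n) (hY n) hz) (hG.norm_yosida_le (ha N) (hY N) hz) t.2
    have hnN : a n ≤ a N := by
      have : (N : ℝ) ≤ n := by exact_mod_cast hn
      exact one_div_le_one_div_of_le (by positivity) (by linarith)
    have h2 : 2 * (a n + a N) * ‖z‖ ^ 2 * (t : ℝ) ≤ 2 * (a N + a N) * ‖z‖ ^ 2 * (t : ℝ) := by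
      gcongr
    rw [dist_eq_norm]
    exact lt_of_pow_lt_pow_left₀ 2 hε.le ((h.trans h2).trans_lt hN)
  have hcau : ∀ (t : ℝ≥0) f, CauchySeq fun n => expHeat (Y n) t f := fun t =>
    cauchySeq_of_dense one_pos (fun n f => by simpa using hE n t f) hD (hcauD t)
  have hlimE : ∀ t : ℝ≥0, ∃ T : H →L[ℝ] H, ∀ f, Tendsto (fun n => expHeat (Y n) t f) atTop
      (𝓝 (T f)) := by
    intro t
    choose q hq using fun f => cauchySeq_tendsto_of_complete (hcau t f)
    exact ⟨continuousLinearMapOfTendsto _ (tendsto_pi_nhds.2 hq), hq⟩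
  choose Q hQ using hlimE
  have hQle : ∀ t f, ‖Q t f‖ ≤ ‖f‖ := fun t f =>
    le_of_tendsto (hQ t f).norm (Eventually.of_forall fun n => hE n t f)
  have hQE : ∀ (t : ℝ≥0) {u : ℕ → H} {f : H}, Tendsto u atTop (𝓝 f) →
      Tendsto (fun n => expHeat (Y n) t (u n)) atTop (𝓝 (Q t f)) := by
    intro t u f hu
    have h1 : Tendsto (fun n => expHeat (Y n) t (u n - f)) atTop (𝓝 0) := by
      refine squeeze_zero_norm (fun n => hE n t _) ?_
      simpa using (hu.sub_const f).norm
    simpa using h1.add (hQ t f)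
  have hYlim : ∀ {f z}, (f, z) ∈ G.graph → Tendsto (fun n => Y n f) atTop (𝓝 z) := by
    intro f z hf
    have haY : ∀ z, Tendsto (fun n => (a n • Y n) z) atTop (𝓝 0) := by
      intro z
      rw [Metric.tendsto_atTop]
      intro ε hε
      obtain ⟨z', hz', hd⟩ := hD.exists_dist_lt z (half_pos hε)
      obtain ⟨y, hy⟩ := LinearPMap.mem_domain_iff.1 hz'
      have h0 : Tendsto (fun n => a n * ‖y‖) atTop (𝓝 0) := by simpa using ha0.mul_const ‖y‖
      obtain ⟨N, hN⟩ := eventually_atTop.1 (h0.eventually (gt_mem_nhds (half_pos hε)))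
      refine ⟨N, fun n hn => ?_⟩
      have h1 : ‖a n • Y n (z - z')‖ ≤ ‖z - z'‖ := by
        have h2 := hG.nonneg _ _ (hY n (z - z'))
        rw [inner_sub_right, inner_smul_right, real_inner_self_eq_norm_sq] at h2
        have h3 := real_inner_le_norm (Y n (z - z')) (z - z')
        rw [norm_smul, Real.norm_of_nonneg (ha n).le]
        rcases (norm_nonneg (Y n (z - z'))).eq_or_lt with h4 | h4
        · rw [← h4]; simp
        · exact le_of_mul_le_mul_right (by nlinarith) h4
      have h2 : ‖a n • Y n z'‖ ≤ a n * ‖y‖ := by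
        rw [norm_smul, Real.norm_of_nonneg (ha n).le]
        exact mul_le_mul_of_nonneg_left (hG.norm_yosida_le (ha n) (hY n) hy) (ha n).le
      have h3 : (a n • Y n) z = a n • Y n (z - z') + a n • Y n z' := by
        rw [map_sub, smul_sub, sub_add_cancel]; rfl
      rw [dist_zero_right, h3]
      rw [dist_eq_norm] at hd
      linarith [norm_add_le (a n • Y n (z - z')) (a n • Y n z'), hN n hn]
    have h1 := (tendsto_const_nhds (x := z)).sub (haY z)
    rw [sub_zero] at h1
    exact h1.congr fun n => (hG.yosida_eq (ha n) (hY n) hf).symm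
  have hEsub : ∀ {f z}, (f, z) ∈ G.graph → ∀ n (t : ℝ), 0 ≤ t →
      ‖expHeat (Y n) t f - f‖ ≤ t * ‖z‖ := by
    intro f z hf n t ht
    have h := norm_image_sub_le_of_norm_deriv_right_le_segment (a := 0) (b := t) (C := ‖z‖)
      (f := fun s => expHeat (Y n) s f) (continuous_expHeat f).continuousOn
      (fun s _ => (hasDerivAt_expHeat s f).hasDerivWithinAt)
      (fun s hs => by
        rw [norm_neg, expHeat_comm]
        exact (norm_expHeat_le (hpos n) hs.1 _).trans (hG.norm_yosida_le (ha n) (hY n) hf))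
      t ⟨ht, le_rfl⟩
    simpa [expHeat_zero, mul_comm] using h
  have hQ0 : ∀ f, Q 0 f = f := fun f =>
    tendsto_nhds_unique (hQ 0 f) (by simp [expHeat_zero])
  have hQadd : ∀ s t f, Q (s + t) f = Q s (Q t f) := fun s t f =>
    tendsto_nhds_unique (hQ (s + t) f)
      ((hQE s (hQ t f)).congr fun n => by rw [NNReal.coe_add, expHeat_add])
  have hQsub : ∀ {f z}, (f, z) ∈ G.graph → ∀ t, ‖Q t f - f‖ ≤ t * ‖z‖ := fun hf t =>
    le_of_tendsto ((hQ t _).sub_const _).norm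
      (Eventually.of_forall fun n => hEsub hf n t t.2)
  have hcont : ∀ f, Continuous fun t => Q t f := by
    intro f
    refine continuous_of_uniform_approx_of_continuous fun U hU => ?_
    obtain ⟨ε, hε, hεU⟩ := Metric.mem_uniformity_dist.1 hU
    obtain ⟨g, hg, hfg⟩ := hD.exists_dist_lt f hε
    obtain ⟨z, hz⟩ := LinearPMap.mem_domain_iff.1 hg
    refine ⟨fun t => Q t g, ?_, fun t => hεU ?_⟩
    · have hle : ∀ s t : ℝ≥0, s ≤ t → dist (Q s g) (Q t g) ≤ ‖z‖₊ * dist s t := by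
        intro s t hst
        obtain ⟨r, rfl⟩ := exists_add_of_le hst
        have h1 : ‖Q s (Q r g - g)‖ ≤ r * ‖z‖ := (hQle s _).trans (hQsub hz r)
        rw [dist_comm, dist_eq_norm, hQadd, ← map_sub]
        simpa [NNReal.dist_eq, mul_comm] using h1
      refine (LipschitzWith.of_dist_le_mul (K := ‖z‖₊) fun s t => ?_).continuous
      rcases le_total s t with h | h
      · exact hle s t h
      · rw [dist_comm, dist_comm s t]; exact hle t s h
    · rw [dist_eq_norm, ← map_sub]
      rw [dist_eq_norm] at hfg
      exact (hQle t _).trans_lt hfg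
  have hsemi : IsContractionSemigroup Q :=
    ⟨ContinuousLinearMap.ext hQ0, fun s t => ContinuousLinearMap.ext (hQadd s t),
      fun t => (Q t).opNorm_le_bound zero_le_one fun f => by simpa using hQle t f, hcont⟩
  -- `-G` is contained in the generator
  have hgen : ∀ {f z}, (f, z) ∈ G.graph →
      Tendsto (fun t : ℝ≥0 => (t : ℝ)⁻¹ • (Q t f - f)) (𝓝[>] 0) (𝓝 (-z)) := by
    intro f z hf
    rw [Metric.tendsto_nhds]
    intro ε hε
    obtain ⟨z', hz', hd⟩ := hD.exists_dist_lt z (show 0 < ε / 4 by positivity)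
    obtain ⟨y, hy⟩ := LinearPMap.mem_domain_iff.1 hz'
    have hsmall : ∀ᶠ t : ℝ≥0 in 𝓝[>] 0, (t : ℝ) * ‖y‖ < ε / 2 := by
      have h1 : Continuous fun t : ℝ≥0 => (t : ℝ) * ‖y‖ := by fun_prop
      have h2 := (h1.tendsto 0).mono_left (nhdsWithin_le_nhds (s := Set.Ioi 0))
      refine h2.eventually (gt_mem_nhds ?_)
      simpa using hε
    filter_upwards [hsmall, self_mem_nhdsWithin] with t hts ht
    have ht' : (0 : ℝ) < t := ht
    have hbound : ‖Q t f - f + (t : ℝ) • z‖ ≤ (2 * ‖z - z'‖ + t * ‖y‖) * t := by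
      have hl := (((hQ t f).sub_const f).add ((hYlim hf).const_smul (t : ℝ))).norm
      have hr : Tendsto (fun n => (2 * ‖Y n f - z'‖ + t * ‖y‖) * (t : ℝ)) atTop
          (𝓝 ((2 * ‖z - z'‖ + t * ‖y‖) * t)) :=
        (((((hYlim hf).sub_const z').norm).const_mul 2).add_const _).mul_const _
      refine le_of_tendsto_of_tendsto' hl hr fun n => ?_
      have h := norm_image_sub_le_of_norm_deriv_right_le_segment (a := 0) (b := t)
        (C := 2 * ‖Y n f - z'‖ + t * ‖y‖)
        (f := fun s => expHeat (Y n) s f + s • Y n f)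
        (f' := fun s => -(Y n (expHeat (Y n) s f)) + (1 : ℝ) • Y n f)
        (Continuous.continuousOn <| by
          have := continuous_expHeat (Y := Y n) f
          fun_prop)
        (fun s _ => ((hasDerivAt_expHeat s f).add
          ((hasDerivAt_id s).smul_const (Y n f))).hasDerivWithinAt)
        (fun s hs => by
          rw [expHeat_comm, one_smul]
          have h1 : -(expHeat (Y n) s (Y n f)) + Y n f = (Y n f - z')
              - expHeat (Y n) s (Y n f - z') - (expHeat (Y n) s z' - z') := by
            rw [map_sub]; abel
          have h2 := norm_expHeat_le (hpos n) hs.1 (Y n f - z')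
          have h3 := hEsub hy n s hs.1
          have h4 : s * ‖y‖ ≤ t * ‖y‖ := mul_le_mul_of_nonneg_right hs.2.le (norm_nonneg y)
          rw [h1]
          have h5 := norm_sub_le ((Y n f - z') - expHeat (Y n) s (Y n f - z'))
            (expHeat (Y n) s z' - z')
          have h6 := norm_sub_le (Y n f - z') (expHeat (Y n) s (Y n f - z'))
          linarith) t ⟨ht'.le, le_rfl⟩
      simp only [expHeat_zero, zero_smul, add_zero, sub_zero] at h
      rwa [add_sub_right_comm] at h
    have heq : (t : ℝ)⁻¹ • (Q t f - f) - -z = (t : ℝ)⁻¹ • (Q t f - f + (t : ℝ) • z) := by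
      rw [smul_add, smul_smul, inv_mul_cancel₀ ht'.ne', one_smul, sub_neg_eq_add]
    rw [dist_eq_norm, heq, norm_smul, norm_inv, Real.norm_of_nonneg ht'.le, ← div_eq_inv_mul,
      div_lt_iff₀ ht']
    rw [dist_eq_norm] at hd
    refine hbound.trans_lt (mul_lt_mul_of_pos_right ?_ ht')
    linarith
  refine ⟨Q, hsemi, fun f g => ⟨fun h => ?_, fun h => ?_⟩, fun t f g => ?_, fun t ht f => ?_⟩
  · simpa using hgen (mem_graph_neg.1 h)
  · -- a proper extension of `-G` would not be dissipative
    obtain ⟨x, z, hxz, hsum⟩ := hG.surj 1 one_pos (f - g)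
    rw [one_smul] at hsum
    have h1 : g - -z = f - x := by
      rw [eq_sub_of_add_eq' hsum]
      abel
    have h2 := hsemi.inner_nonpos (f := f - x) (g := g - -z) <|
      (h.sub (hgen hxz)).congr fun t => by
        rw [← smul_sub, map_sub]; congr 1; abel
    rw [h1, real_inner_self_eq_norm_sq] at h2
    have h3 : f = x := by
      have : ‖f - x‖ ^ 2 = 0 := le_antisymm h2 (sq_nonneg _)
      simpa [sub_eq_zero] using this
    subst h3
    rw [sub_self, sub_neg_eq_add] at h1
    rwa [mem_graph_neg, ← eq_neg_of_add_eq_zero_right h1]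
  · refine tendsto_nhds_unique ((hQ t f).inner (tendsto_const_nhds (x := g))) ?_
    exact ((tendsto_const_nhds (x := f)).inner (hQ t g)).congr fun n =>
      (expHeat_symm (hsym n) t f g).symm
  · have ht' : (0 : ℝ) < t := ht
    have hcauY : CauchySeq fun n => ((Y n).comp (expHeat (Y n) t)) f := by
      refine cauchySeq_of_dense (inv_pos.2 ht') (fun n f => ?_) hD (fun f hf => ?_) f
      · rw [← div_eq_inv_mul, le_div_iff₀ ht', mul_comm]
        exact mul_norm_expHeat_le (hsym n) (hpos n) ht'.le f
      · obtain ⟨z, hz⟩ := LinearPMap.mem_domain_iff.1 hf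
        exact ((hQE t (hYlim hz)).congr fun n => (expHeat_comm _ _).symm).cauchySeq
    obtain ⟨w, hw⟩ := cauchySeq_tendsto_of_complete hcauY
    have h1 : Tendsto (fun n => expHeat (Y n) t f - a n • Y n (expHeat (Y n) t f)) atTop
        (𝓝 (Q t f)) := by
      simpa using (hQ t f).sub (ha0.smul hw)
    exact LinearPMap.mem_domain_of_mem_graph (y := w) <|
      hG.isClosed.mem_of_tendsto (h1.prodMk_nhds hw)
        (Eventually.of_forall fun n => hY n (expHeat (Y n) t f))

end IsNonnegSelfAdjoint

end HilleYosida

/-! ### From the semigroup to the bounded form `⟪f, G (m + G)⁻¹ f⟫` -/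

section ResolventForm

variable {H : Type*} [NormedAddCommGroup H] [InnerProductSpace ℝ H]

theorem isNonnegSelfAdjoint_adjoint_mul_closure [CompleteSpace H] {A : H →ₗ.[ℝ] H}
    (hA : Dense (A.domain : Set H)) (hc : A.IsClosable) :
    IsNonnegSelfAdjoint (opMul A† A.closure) where
  symm x z x' z' h h' := by
    obtain ⟨y, hxy, hyz⟩ := mem_graph_opMul.1 h
    obtain ⟨y', hxy', hyz'⟩ := mem_graph_opMul.1 h'
    rw [← inner_closure_adjoint hA hc hxy hyz', real_inner_comm,
      ← inner_closure_adjoint hA hc hxy' hyz, real_inner_comm]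
  nonneg x z h := by
    obtain ⟨y, hxy, hyz⟩ := mem_graph_opMul.1 h
    rw [real_inner_comm, ← inner_closure_adjoint hA hc hxy hyz, real_inner_self_eq_norm_sq]
    exact sq_nonneg _
  surj m hm g := by
    obtain ⟨x, y, z, hxy, hyz, h⟩ := exists_resolvent_adjoint_mul_closure hA hc hm g
    exact ⟨x, z, mem_graph_opMul.2 ⟨y, hxy, hyz⟩, h⟩

variable {G : H →ₗ.[ℝ] H} {Q : ℝ≥0 → H →L[ℝ] H}

/-- Exponential decay of `‖Q t f‖²` towards `M` from the differential inequality. As `f` itself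
need not lie in the domain of `G`, the inequality is integrated from a positive time, which then
tends to `0`. -/
theorem norm_sq_semigroup_le (hQ : IsContractionSemigroup Q) (hgen : IsGeneratorOf (-G) Q)
    (hdom : ∀ t, 0 < t → ∀ f, Q t f ∈ G.domain) {α M : ℝ} (hα : 0 < α) {f : H}
    (hf : ∀ t, 0 < t → ∀ z, (Q t f, z) ∈ G.graph → ‖Q t f‖ ^ 2 ≤ α * ⟪z, Q t f⟫_ℝ + M)
    {t : ℝ} (ht : 0 ≤ t) :
    ‖Q t.toNNReal f‖ ^ 2 ≤ Real.exp (-(2 / α * t)) * (‖f‖ ^ 2 - M) + M := by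
  have key : ∀ s : ℝ≥0, 0 < s → Real.exp (2 / α * t) * (‖Q t.toNNReal (Q s f)‖ ^ 2 - M)
      ≤ ‖Q s f‖ ^ 2 - M := by
    intro s hs
    obtain ⟨z, hz⟩ := LinearPMap.mem_domain_iff.1 (hdom s hs f)
    have hz' : (Q s f, -z) ∈ (-G).graph := mem_graph_neg.2 (by rwa [neg_neg])
    have hc := (hQ.continuous_toNNReal (Q s f)).norm
    refine image_le_of_deriv_right_le_deriv_boundary (a := 0) (b := t)
      (f := fun r => Real.exp (2 / α * r) * (‖Q r.toNNReal (Q s f)‖ ^ 2 - M))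
      (B := fun _ => ‖Q s f‖ ^ 2 - M) (B' := fun _ => 0)
      (Continuous.continuousOn (by fun_prop))
      (fun r hr => ((((hasDerivAt_id r).const_mul (2 / α)).exp).hasDerivWithinAt).mul
        (((hgen.hasDerivWithinAt hQ hz' hr.1).norm_sq).sub_const M))
      (by simp [hQ.apply_zero]) continuousOn_const
      (fun r _ => hasDerivWithinAt_const _ _ _) (fun r hr => ?_) ⟨ht, le_rfl⟩
    have hmem : (Q (r.toNNReal + s) f, Q r.toNNReal z) ∈ G.graph := by
      have := hgen.map_mem_graph hQ hz' r.toNNReal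
      rwa [mem_graph_neg, map_neg, neg_neg, ← hQ.apply_add] at this
    have hle := hf _ (add_pos_of_nonneg_of_pos (zero_le) hs) _ hmem
    rw [hQ.apply_add] at hle
    rw [map_neg, inner_neg_right, real_inner_comm]
    have h1 : 2 / α * (‖Q r.toNNReal (Q s f)‖ ^ 2 - M)
        ≤ 2 * ⟪Q r.toNNReal z, Q r.toNNReal (Q s f)⟫_ℝ := by
      rw [div_mul_eq_mul_div, div_le_iff₀ hα]
      linarith
    have h2 := Real.exp_pos (2 / α * r)
    simp only [id, mul_one]
    nlinarith
  have hlim : ‖Q t.toNNReal f‖ ^ 2 - M ≤ Real.exp (-(2 / α * t)) * (‖f‖ ^ 2 - M) := by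
    have h0 := (hQ.continuous f).tendsto 0
    rw [hQ.apply_zero] at h0
    have h1 : Tendsto (fun s => Q s f) (𝓝[>] 0) (𝓝 f) := h0.mono_left nhdsWithin_le_nhds
    have h2 := ((((Q t.toNNReal).continuous.tendsto f).comp h1).norm.pow 2).sub_const M
    have h3 := (((h1.norm.pow 2).sub_const M).const_mul (Real.exp (-(2 / α * t))))
    refine le_of_tendsto_of_tendsto h2 h3 ?_
    filter_upwards [self_mem_nhdsWithin] with s hs
    rw [Real.exp_neg, ← div_eq_inv_mul, le_div_iff₀ (Real.exp_pos _), mul_comm]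
    exact key s hs
  linarith

/-- A weak Poincaré inequality along the semigroup of `G` gives one for the bounded form
`⟪G (m + G)⁻¹ f, f⟫`, since `(m + G)⁻¹` is the Laplace transform of the semigroup. Here
`u = (m + G)⁻¹ f`. -/
theorem norm_sq_le_resolvent_form (hQ : IsContractionSemigroup Q) (hgen : IsGeneratorOf (-G) Q)
    (hsym : ∀ t f g, ⟪Q t f, g⟫_ℝ = ⟪f, Q t g⟫_ℝ) (hdom : ∀ t, 0 < t → ∀ f, Q t f ∈ G.domain)
    {α m M : ℝ} (hα : 0 < α) (hm : 0 < m) {f u : H} (hu : (u, f - m • u) ∈ G.graph)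
    (hf : ∀ t, 0 < t → ∀ z, (Q t f, z) ∈ G.graph → ‖Q t f‖ ^ 2 ≤ α * ⟪z, Q t f⟫_ℝ + M) :
    ‖f‖ ^ 2 ≤ (1 + m * α) * ⟪f - m • u, f⟫_ℝ + M := by
  set F := ‖f‖ ^ 2 with hF
  set β := m + 1 / α with hβ
  have hβ0 : 0 < β := by positivity
  have hu' : (u, -(f - m • u)) ∈ (-G).graph := mem_graph_neg.2 (by rwa [neg_neg])
  have hQf : ∀ t : ℝ, 0 ≤ t →
      ⟪Q t.toNNReal f, f⟫_ℝ ≤ Real.exp (-(1 / α * t)) * (F - M) + M := by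
    intro t ht
    have ht2 : 0 ≤ t / 2 := by positivity
    have h := norm_sq_semigroup_le hQ hgen hdom hα hf ht2
    have h2 : t.toNNReal = (t / 2).toNNReal + (t / 2).toNNReal := by
      rw [← Real.toNNReal_add ht2 ht2, add_halves]
    rw [h2, hQ.apply_add, hsym, real_inner_self_eq_norm_sq]
    rwa [show 2 / α * (t / 2) = 1 / α * t by ring] at h
  have hc := (hQ.continuous_toNNReal u).inner (continuous_const (y := f)) (𝕜 := ℝ)
  -- `-e^{-m t} ⟪Q t u, f⟫` has derivative `e^{-m t} ⟪Q t f, f⟫`; the right side integrates `hQf`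
  have key : ∀ t : ℝ, 0 ≤ t → -(Real.exp (-(m * t)) * ⟪Q t.toNNReal u, f⟫_ℝ)
      ≤ -⟪u, f⟫_ℝ + (F - M) * ((1 - Real.exp (-(β * t))) / β)
        + M * ((1 - Real.exp (-(m * t))) / m) := by
    intro t ht
    have hexp : ∀ c r : ℝ, HasDerivAt (fun r => Real.exp (-(c * r)))
        (-(c * Real.exp (-(c * r)))) r := fun c r =>
      (((hasDerivAt_id r).const_mul c).neg.exp).congr_deriv (by simp only [Pi.neg_apply, id]; ring)
    have hB : ∀ c r : ℝ, 0 < c → HasDerivAt (fun r => (1 - Real.exp (-(c * r))) / c)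
        (Real.exp (-(c * r))) r := fun c r hc =>
      (((hexp c r).const_sub 1).div_const c).congr_deriv (by field_simp)
    refine image_le_of_deriv_right_le_deriv_boundary (a := 0) (b := t)
      (f := fun t => -(Real.exp (-(m * t)) * ⟪Q t.toNNReal u, f⟫_ℝ))
      (B := fun t => -⟪u, f⟫_ℝ + (F - M) * ((1 - Real.exp (-(β * t))) / β)
        + M * ((1 - Real.exp (-(m * t))) / m))
      (Continuous.continuousOn (by fun_prop))
      (fun r hr => ((hexp m r).hasDerivWithinAt.mul
        ((hgen.hasDerivWithinAt hQ hu' hr.1).inner ℝ (hasDerivWithinAt_const r _ f))).neg)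
      (by simp [hQ.apply_zero]) (Continuous.continuousOn (by fun_prop))
      (fun r _ => ((((hB β r hβ0).const_mul (F - M)).const_add _).add
        ((hB m r hm).const_mul M)).hasDerivWithinAt)
      (fun r hr => ?_) ⟨ht, le_rfl⟩
    have h1 := hQf r hr.1
    have h2 := Real.exp_pos (-(m * r))
    have h3 : Real.exp (-(β * r)) = Real.exp (-(m * r)) * Real.exp (-(1 / α * r)) := by
      rw [← Real.exp_add, hβ]; ring_nf
    rw [h3]
    simp only [map_neg, map_sub, map_smul, inner_neg_left, inner_sub_left, inner_smul_left,
      RCLike.conj_to_real, inner_zero_right]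
    nlinarith
  have hexp0 : ∀ c : ℝ, 0 < c → Tendsto (fun t : ℝ => Real.exp (-(c * t))) atTop (𝓝 0) :=
    fun c hc => Real.tendsto_exp_neg_atTop_nhds_zero.comp (tendsto_id.const_mul_atTop hc)
  have hφ : Tendsto (fun t : ℝ => -(Real.exp (-(m * t)) * ⟪Q t.toNNReal u, f⟫_ℝ)) atTop (𝓝 0) := by
    refine squeeze_zero_norm (a := fun t => Real.exp (-(m * t)) * (‖u‖ * ‖f‖)) (fun t => ?_) ?_
    · rw [norm_neg, norm_mul, Real.norm_of_nonneg (Real.exp_pos _).le]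
      gcongr
      exact (norm_inner_le_norm _ _).trans
        (mul_le_mul_of_nonneg_right (hQ.norm_apply_le _ u) (norm_nonneg f))
    · simpa using (hexp0 m hm).mul_const (‖u‖ * ‖f‖)
  have hRHS : Tendsto (fun t : ℝ => -⟪u, f⟫_ℝ + (F - M) * ((1 - Real.exp (-(β * t))) / β)
        + M * ((1 - Real.exp (-(m * t))) / m)) atTop
      (𝓝 (-⟪u, f⟫_ℝ + (F - M) * ((1 - 0) / β) + M * ((1 - 0) / m))) :=
    (((((hexp0 β hβ0).const_sub 1).div_const β).const_mul (F - M)).const_add _).add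
      ((((hexp0 m hm).const_sub 1).div_const m).const_mul M)
  have hfin := le_of_tendsto_of_tendsto hφ hRHS
    (by filter_upwards [eventually_ge_atTop 0] with t ht using key t ht)
  have hΛ : ⟪f - m • u, f⟫_ℝ = F - m * ⟪u, f⟫_ℝ := by
    rw [inner_sub_left, inner_smul_left, RCLike.conj_to_real, real_inner_self_eq_norm_sq]
  rw [hΛ]
  have h1 : ⟪u, f⟫_ℝ ≤ (F - M) / β + M / m := by
    have : (F - M) * ((1 - 0) / β) + M * ((1 - 0) / m) = (F - M) / β + M / m := by ring
    linarith
  have hβα : β = (1 + m * α) / α := by rw [hβ]; field_simp; ring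
  have hp : 0 < 1 + m * α := by positivity
  have h2 : (1 + m * α) * (m * ⟪u, f⟫_ℝ) ≤ (F - M) * (m * α) + (1 + m * α) * M := by
    have h3 : (1 + m * α) * (m * ((F - M) / β + M / m)) = (F - M) * (m * α) + (1 + m * α) * M := by
      rw [hβα]; field_simp
    rw [← h3]
    exact mul_le_mul_of_nonneg_left (mul_le_mul_of_nonneg_left h1 hm.le) hp.le
  linarith

end ResolventForm

/-! ### The Lyapunov functional -/

section Lyapunov

theorem le_exp_mul_add_of_deriv_right_le {φ φ' : ℝ → ℝ} {k N : ℝ} (hk : 0 < k)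
    (hc : Continuous φ) (hd : ∀ t, 0 ≤ t → HasDerivWithinAt φ (φ' t) (Set.Ici t) t)
    (hle : ∀ t, 0 ≤ t → φ' t ≤ -(k * φ t) + N) {t : ℝ} (ht : 0 ≤ t) :
    φ t ≤ Real.exp (-(k * t)) * (φ 0 - N / k) + N / k := by
  have h := image_le_of_deriv_right_le_deriv_boundary (a := 0) (b := t)
    (f := fun r => Real.exp (k * r) * (φ r - N / k))
    (B := fun _ => φ 0 - N / k) (B' := fun _ => 0)
    (Continuous.continuousOn (by fun_prop))
    (fun r hr => ((((hasDerivAt_id r).const_mul k).exp).hasDerivWithinAt).mul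
      ((hd r hr.1).sub_const (N / k)))
    (by simp) continuousOn_const (fun r _ => hasDerivWithinAt_const _ _ _)
    (fun r hr => by
      have h1 := hle r hr.1
      have h2 := Real.exp_pos (k * r)
      have h3 : k * (φ r - N / k) = k * φ r - N := by field_simp
      simp only [id, mul_one]
      nlinarith) ⟨ht, le_rfl⟩
  have h2 : Real.exp (-(k * t)) * (Real.exp (k * t) * (φ t - N / k)) = φ t - N / k := by
    rw [← mul_assoc, ← Real.exp_add, neg_add_cancel, Real.exp_zero, one_mul]
  have h3 := mul_le_mul_of_nonneg_left h (Real.exp_pos (-(k * t))).le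
  rw [h2] at h3
  linarith

/-- The dissipation of `‖u‖² / 2 - ε ⟪u, K u⟫` with `ε = θ / (2 R₀² C_P)`: here `a` and `b` are the
norms of the two components of `u`, `D` is the dissipation of `‖u‖² / 2`, and `X`, `Y` are the
derivative and the value of `⟪u, K u⟫`. -/
theorem lyapunov_dissipation {a b D X Y Λ M R₀ C_P θ lam : ℝ} (ha : 0 ≤ a) (hb : 0 ≤ b)
    (hR₀ : 1 ≤ R₀) (hC : 0 < C_P) (hθ : 0 < θ) (hθ1 : θ ≤ 1) (hlam : 0 < lam)
    (hlamθ : lam * (2 + θ) ≤ θ ^ 2 / R₀ ^ 2) (hD : a ^ 2 ≤ C_P * D)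
    (hX : Λ - R₀ * a * b - a ^ 2 ≤ X) (hΛ : θ * b ^ 2 ≤ Λ + θ * M) (hY : |Y| ≤ R₀ * C_P * a * b) :
    -D - θ / (2 * R₀ ^ 2 * C_P) * X
      ≤ -(lam / C_P * (1 / 2 * (a ^ 2 + b ^ 2) - θ / (2 * R₀ ^ 2 * C_P) * Y))
        + θ ^ 2 / (2 * R₀ ^ 2 * C_P) * M := by
  have hR0 : 0 < R₀ := by linarith
  set q := θ / R₀ with hq
  have hq0 : 0 < q := by positivity
  have hqθ : q ≤ θ := div_le_self hθ.le hR₀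
  have hqR : q / R₀ ≤ q := div_le_self hq0.le hR₀
  have hε : θ / (2 * R₀ ^ 2 * C_P) = (q / R₀) / (2 * C_P) := by rw [hq]; field_simp
  have hεM : θ ^ 2 / (2 * R₀ ^ 2 * C_P) = q ^ 2 / (2 * C_P) := by rw [hq]; field_simp
  have hlq : lam * (2 + θ) ≤ q ^ 2 := by rwa [hq, div_pow]
  -- the correction term is dominated by the norm
  have hYb : -((q / R₀) / C_P * Y) ≤ θ / 2 * (a ^ 2 + b ^ 2) := by
    have h1 : -Y ≤ R₀ * C_P * a * b := (neg_le_abs Y).trans hY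
    have h2 : (q / R₀) / C_P * (-Y) ≤ (q / R₀) / C_P * (R₀ * C_P * a * b) :=
      mul_le_mul_of_nonneg_left h1 (by positivity)
    have h3 : (q / R₀) / C_P * (R₀ * C_P * a * b) = q * (a * b) := by field_simp
    have h4 : q * (a * b) ≤ θ * (a * b) := mul_le_mul_of_nonneg_right hqθ (mul_nonneg ha hb)
    nlinarith [sq_nonneg (a - b)]
  -- the derivative of the correction, multiplied by `2 C_P`
  have hXb : q ^ 2 * (b ^ 2 - M) - q * (a * b) - q * a ^ 2 ≤ (q / R₀) * X := by
    have h1 : (q / R₀) * (θ * (b ^ 2 - M) - R₀ * a * b - a ^ 2) ≤ (q / R₀) * X :=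
      mul_le_mul_of_nonneg_left (by linarith) (by positivity)
    have h2 : (q / R₀) * (θ * (b ^ 2 - M) - R₀ * a * b - a ^ 2)
        = q ^ 2 * (b ^ 2 - M) - q * (a * b) - (q / R₀) * a ^ 2 := by rw [hq]; field_simp
    have h3 : (q / R₀) * a ^ 2 ≤ q * a ^ 2 := mul_le_mul_of_nonneg_right hqR (sq_nonneg a)
    linarith
  have hkey : -(2 * C_P * D) - (q / R₀) * X
      ≤ -(lam * ((a ^ 2 + b ^ 2) - (q / R₀) / C_P * Y)) + q ^ 2 * M := by
    have h1 : lam * ((a ^ 2 + b ^ 2) - (q / R₀) / C_P * Y)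
        ≤ lam * ((1 + θ / 2) * (a ^ 2 + b ^ 2)) :=
      mul_le_mul_of_nonneg_left (by linarith) hlam.le
    have h2 : lam * ((1 + θ / 2) * (a ^ 2 + b ^ 2)) ≤ q ^ 2 / 2 * (a ^ 2 + b ^ 2) := by
      have h3 : 0 ≤ a ^ 2 + b ^ 2 := by positivity
      nlinarith
    have h4 : q ^ 2 ≤ 1 := by nlinarith
    have h5 : q * (a * b) ≤ q ^ 2 / 2 * b ^ 2 + a ^ 2 / 2 := by nlinarith [sq_nonneg (q * b - a)]
    have h6 : q ^ 2 / 2 * a ^ 2 ≤ 1 / 2 * a ^ 2 :=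
      mul_le_mul_of_nonneg_right (by linarith) (sq_nonneg a)
    have h7 : q * a ^ 2 ≤ 1 * a ^ 2 := mul_le_mul_of_nonneg_right (by linarith) (sq_nonneg a)
    linarith
  rw [hε, hεM]
  have hfin := mul_le_mul_of_nonneg_left hkey (show 0 ≤ 1 / (2 * C_P) by positivity)
  have e1 : 1 / (2 * C_P) * (-(2 * C_P * D) - (q / R₀) * X) = -D - (q / R₀) / (2 * C_P) * X := by
    field_simp
  have e2 : 1 / (2 * C_P) * (-(lam * ((a ^ 2 + b ^ 2) - (q / R₀) / C_P * Y)) + q ^ 2 * M)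
      = -(lam / C_P * (1 / 2 * (a ^ 2 + b ^ 2) - (q / R₀) / (2 * C_P) * Y))
        + q ^ 2 / (2 * C_P) * M := by
    field_simp
  rwa [e1, e2] at hfin

variable {H : Type*} [NormedAddCommGroup H] [InnerProductSpace ℝ H]
  {P : ℝ≥0 → H →L[ℝ] H} {L : H →ₗ.[ℝ] H}

/-- Decay along an orbit from the dissipation inequalities that hold along it, through the modified
norm `‖u‖² / 2 - ε ⟪u, K u⟫`, which is equivalent to `‖u‖²`. -/
theorem norm_sq_le_of_lyapunov (hP : IsContractionSemigroup P) (hL : IsGeneratorOf L P)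
    {p : H → H} {K : H →L[ℝ] H} {Λ : H → ℝ} {f g : H} (hfg : (f, g) ∈ L.graph)
    {R₀ C_P θ lam M : ℝ} (hR₀ : 1 ≤ R₀) (hC : 0 < C_P) (hθ : 0 < θ) (hθ1 : θ ≤ 1)
    (hlam : 0 < lam) (hlamθ : lam * (2 + θ) ≤ θ ^ 2 / R₀ ^ 2) (hM : 0 ≤ M)
    (hpyth : ∀ u, ‖u‖ ^ 2 = ‖u - p u‖ ^ 2 + ‖p u‖ ^ 2)
    (hdiss : ∀ u v, (u, v) ∈ L.graph → ‖u - p u‖ ^ 2 ≤ C_P * (-⟪v, u⟫_ℝ))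
    (hcross : ∀ u v, (u, v) ∈ L.graph → Λ u - R₀ * ‖u - p u‖ * ‖p u‖ - ‖u - p u‖ ^ 2
      ≤ ⟪v, K u⟫_ℝ + ⟪u, K v⟫_ℝ)
    (hK : ∀ u, |⟪u, K u⟫_ℝ| ≤ R₀ * C_P * ‖u - p u‖ * ‖p u‖)
    (hΛ : ∀ t, θ * ‖p (P t f)‖ ^ 2 ≤ Λ (P t f) + θ * M) (t : ℝ≥0) :
    ‖P t f‖ ^ 2 ≤ 3 * Real.exp (-(lam / C_P * t)) * ‖f‖ ^ 2 + 2 * θ ^ 2 / (R₀ ^ 2 * lam) * M := by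
  have hR0 : 0 < R₀ := by linarith
  set ε := θ / (2 * R₀ ^ 2 * C_P) with hε
  have hε0 : 0 < ε := by positivity
  have hequiv : ∀ u, |ε * ⟪u, K u⟫_ℝ| ≤ 1 / 4 * ‖u‖ ^ 2 := by
    intro u
    rw [abs_mul, abs_of_pos hε0, hpyth u]
    have h1 := mul_le_mul_of_nonneg_left (hK u) hε0.le
    have h2 : ε * (R₀ * C_P * ‖u - p u‖ * ‖p u‖) = (θ / R₀) / 2 * (‖u - p u‖ * ‖p u‖) := by
      rw [hε]; field_simp
    have h3 : θ / R₀ ≤ 1 := (div_le_self hθ.le hR₀).trans hθ1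
    have h4 : (θ / R₀) / 2 * (‖u - p u‖ * ‖p u‖) ≤ 1 / 2 * (‖u - p u‖ * ‖p u‖) :=
      mul_le_mul_of_nonneg_right (by linarith) (by positivity)
    nlinarith [sq_nonneg (‖u - p u‖ - ‖p u‖)]
  set φ : ℝ → ℝ := fun s => 1 / 2 * ‖P s.toNNReal f‖ ^ 2
    - ε * ⟪P s.toNNReal f, K (P s.toNNReal f)⟫_ℝ with hφ
  have hcP := hP.continuous_toNNReal f
  have hcφ : Continuous φ :=
    ((hcP.norm.pow 2).const_mul _).sub ((hcP.inner (K.continuous.comp hcP)).const_mul _)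
  have hd : ∀ s, 0 ≤ s → HasDerivWithinAt φ (1 / 2 * (2 * ⟪P s.toNNReal f, P s.toNNReal g⟫_ℝ)
      - ε * (⟪P s.toNNReal f, K (P s.toNNReal g)⟫_ℝ + ⟪P s.toNNReal g, K (P s.toNNReal f)⟫_ℝ))
      (Set.Ici s) s := by
    intro s hs
    have h1 := hL.hasDerivWithinAt hP hfg hs
    have h2 : HasDerivWithinAt (fun r : ℝ => K (P r.toNNReal f)) (K (P s.toNNReal g))
        (Set.Ici s) s := K.hasFDerivAt.comp_hasDerivWithinAt s h1
    exact (h1.norm_sq.const_mul _).sub ((h1.inner ℝ h2).const_mul _)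
  have hle : ∀ s, 0 ≤ s → 1 / 2 * (2 * ⟪P s.toNNReal f, P s.toNNReal g⟫_ℝ)
      - ε * (⟪P s.toNNReal f, K (P s.toNNReal g)⟫_ℝ + ⟪P s.toNNReal g, K (P s.toNNReal f)⟫_ℝ)
      ≤ -(lam / C_P * φ s) + θ ^ 2 / (2 * R₀ ^ 2 * C_P) * M := by
    intro s _
    have hmem := hL.map_mem_graph hP hfg s.toNNReal
    have h := lyapunov_dissipation (norm_nonneg (P s.toNNReal f - p (P s.toNNReal f)))
      (norm_nonneg (p (P s.toNNReal f))) hR₀ hC hθ hθ1 hlam hlamθ (hdiss _ _ hmem)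
      (hcross _ _ hmem) (hΛ _) (hK _)
    rw [← hpyth, real_inner_comm (P s.toNNReal f)] at h
    simp only [hφ]
    linarith
  have hgr := le_exp_mul_add_of_deriv_right_le (div_pos hlam hC) hcφ hd hle t.coe_nonneg
  have hN : θ ^ 2 / (2 * R₀ ^ 2 * C_P) * M / (lam / C_P) = θ ^ 2 / (2 * R₀ ^ 2 * lam) * M := by
    field_simp
  rw [hN] at hgr
  have h0 : φ 0 ≤ 3 / 4 * ‖f‖ ^ 2 := by
    have h1 := (abs_le.1 (hequiv f)).1
    simp only [hφ, Real.toNNReal_zero, hP.apply_zero]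
    linarith
  have h1 : 1 / 4 * ‖P t f‖ ^ 2 ≤ φ t := by
    have h2 := (abs_le.1 (hequiv (P t f))).2
    simp only [hφ, Real.toNNReal_coe]
    linarith
  have he0 := Real.exp_pos (-(lam / C_P * t))
  have h2 : Real.exp (-(lam / C_P * t)) * φ 0
      ≤ Real.exp (-(lam / C_P * t)) * (3 / 4 * ‖f‖ ^ 2) :=
    mul_le_mul_of_nonneg_left h0 he0.le
  have h3 : 0 ≤ Real.exp (-(lam / C_P * t)) * (θ ^ 2 / (2 * R₀ ^ 2 * lam) * M) := by positivity
  have h4 : 2 * θ ^ 2 / (R₀ ^ 2 * lam) * M = 4 * (θ ^ 2 / (2 * R₀ ^ 2 * lam) * M) := by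
    field_simp
    ring
  rw [h4]
  rw [mul_sub] at hgr
  linarith

end Lyapunov

/-! ### The bounded operators `(m + A* cl(A))⁻¹` and `cl(A) (m + A* cl(A))⁻¹` -/

section Factor

variable {H : Type*} [NormedAddCommGroup H] [InnerProductSpace ℝ H]

/-- The closure of a densely defined restriction of a bounded operator is this operator. -/
theorem opEval_closure_of_le_clm {F : H →ₗ.[ℝ] H} {S : H →L[ℝ] H}
    (hF : ∀ x y, (x, y) ∈ F.graph → y = S x) (hd : Dense (F.domain : Set H)) (x : H) :
    opEval F.closure x = S x := by
  have hc : F.IsClosable := by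
    refine ⟨F.graph.topologicalClosure.toLinearPMap, ?_⟩
    rw [Submodule.toLinearPMap_graph_eq]
    rintro ⟨x, y⟩ hx (rfl : x = 0)
    rw [← SetLike.mem_coe, Submodule.topologicalClosure_coe, mem_closure_iff_seq_limit] at hx
    obtain ⟨p, hp, hlim⟩ := hx
    rw [nhds_prod_eq, tendsto_prod_iff'] at hlim
    have h1 := (S.continuous.tendsto _).comp hlim.1
    rw [map_zero] at h1
    exact tendsto_nhds_unique hlim.2 (h1.congr fun n => (hF _ _ (hp n)).symm)
  refine opEval_of_mem_graph ((mem_graph_closure hc).2 ?_)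
  obtain ⟨u, hu, hlim⟩ := mem_closure_iff_seq_limit.1 (hd x)
  refine ⟨u, fun n => S (u n), fun n => ?_, hlim, (S.continuous.tendsto x).comp hlim⟩
  obtain ⟨y, hy⟩ := LinearPMap.mem_domain_iff.1 (hu n)
  rw [hF _ _ hy] at hy
  exact hy

variable [CompleteSpace H]

/-- `R` is `(m + A* cl(A))⁻¹` and `K` is `cl(A) (m + A* cl(A))⁻¹`. -/
structure IsResolventPair (A : H →ₗ.[ℝ] H) (m : ℝ) (R K : H →L[ℝ] H) : Prop where
  mem_closure : ∀ g, (R g, K g) ∈ A.closure.graph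
  mem_adjoint : ∀ g, (K g, g - m • R g) ∈ A†.graph

theorem exists_isResolventPair {A : H →ₗ.[ℝ] H} (hA : Dense (A.domain : Set H))
    (hc : A.IsClosable) {m : ℝ} (hm : 0 < m) : ∃ R K, IsResolventPair A m R K := by
  have hG := isNonnegSelfAdjoint_adjoint_mul_closure hA hc
  obtain ⟨R, hR⟩ := hG.exists_resolvent hm
  choose K hK using fun g => mem_graph_opMul.1 (hR g)
  have hbound : ∀ g, ‖K g‖ ≤ (1 + 1 / m) * ‖g‖ := by
    intro g
    have h1 : ‖K g‖ ^ 2 = ⟪R g, g⟫_ℝ - m * ‖R g‖ ^ 2 := by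
      rw [← real_inner_self_eq_norm_sq, inner_closure_adjoint hA hc (hK g).1 (hK g).2,
        inner_sub_right, inner_smul_right, real_inner_self_eq_norm_sq]
    have h2 := real_inner_le_norm (R g) g
    have h3 : ‖K g‖ ^ 2 ≤ (1 / m) * ‖g‖ ^ 2 := by
      rw [one_div_mul_eq_div, le_div_iff₀ hm]
      have h4 := mul_le_mul_of_nonneg_left h2 hm.le
      rw [h1]
      nlinarith [sq_nonneg (m * ‖R g‖ - ‖g‖ / 2)]
    refine (sq_le_sq₀ (norm_nonneg _) (by positivity)).1 (h3.trans ?_)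
    have h4 : 0 < 1 / m := by positivity
    nlinarith [sq_nonneg ‖g‖, mul_nonneg h4.le (sq_nonneg ‖g‖),
      mul_nonneg (mul_nonneg h4.le h4.le) (sq_nonneg ‖g‖)]
  let K₀ : H →ₗ[ℝ] H :=
    { toFun := K
      map_add' := fun g h => by
        have h1 := A.closure.graph.add_mem (hK g).1 (hK h).1
        exact A.closure.mem_graph_snd_inj (hK (g + h)).1 h1 (map_add R g h)
      map_smul' := fun c g => by
        have h1 := A.closure.graph.smul_mem c (hK g).1
        exact A.closure.mem_graph_snd_inj (hK (c • g)).1 h1 (map_smul R c g) }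
  exact ⟨R, K₀.mkContinuous _ hbound, fun g => (hK g).1, fun g => (hK g).2⟩

namespace IsResolventPair

variable {A : H →ₗ.[ℝ] H} {m : ℝ} {R K : H →L[ℝ] H}

theorem mem_graph (h : IsResolventPair A m R K) (g : H) :
    (R g, g - m • R g) ∈ (opMul A† A.closure).graph :=
  mem_graph_opMul.2 ⟨K g, h.mem_closure g, h.mem_adjoint g⟩

theorem symm (h : IsResolventPair A m R K) (hA : Dense (A.domain : Set H)) (hc : A.IsClosable)
    (f g : H) : ⟪R f, g⟫_ℝ = ⟪f, R g⟫_ℝ := by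
  have h1 := (isNonnegSelfAdjoint_adjoint_mul_closure hA hc).symm _ _ _ _
    (h.mem_graph f) (h.mem_graph g)
  simp only [inner_sub_left, inner_sub_right, inner_smul_left, inner_smul_right,
    RCLike.conj_to_real] at h1
  linarith

theorem inner_eq (h : IsResolventPair A m R K) (hA : Dense (A.domain : Set H))
    (hc : A.IsClosable) {y w : H} (hyw : (y, w) ∈ A†.graph) (g : H) :
    ⟪y, K g⟫_ℝ = ⟪R w, g⟫_ℝ := by
  rw [real_inner_comm, inner_closure_adjoint hA hc (h.mem_closure g) hyw, h.symm hA hc,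
    real_inner_comm]

theorem norm_sq_eq (h : IsResolventPair A m R K) (hA : Dense (A.domain : Set H))
    (hc : A.IsClosable) (g : H) : ‖K g‖ ^ 2 = ⟪R g, g⟫_ℝ - m * ‖R g‖ ^ 2 := by
  rw [← real_inner_self_eq_norm_sq,
    inner_closure_adjoint hA hc (h.mem_closure g) (h.mem_adjoint g),
    inner_sub_right, inner_smul_right, real_inner_self_eq_norm_sq]

/-- `⟪g, G (m + G)⁻¹ g⟫ = m ‖K g‖² + ‖G (m + G)⁻¹ g‖²` for `G = A* cl(A)`. -/
theorem inner_form_eq (h : IsResolventPair A m R K) (hA : Dense (A.domain : Set H))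
    (hc : A.IsClosable) (g : H) :
    ⟪g, g - m • R g⟫_ℝ = m * ‖K g‖ ^ 2 + ‖g - m • R g‖ ^ 2 := by
  rw [h.norm_sq_eq hA hc, ← real_inner_self_eq_norm_sq (g - m • R g),
    ← real_inner_self_eq_norm_sq (R g)]
  simp only [inner_sub_left, inner_sub_right, inner_smul_left, inner_smul_right,
    RCLike.conj_to_real]
  ring

/-- On the kernel of `A` the operator `R` is `1 / m` and `K` vanishes. -/
theorem of_mem_ker (h : IsResolventPair A m R K) (hA : Dense (A.domain : Set H))
    (hc : A.IsClosable) (hm : 0 < m) {x : H} (hx : (x, 0) ∈ A.closure.graph) :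
    m • R x = x ∧ K x = 0 := by
  have hG := isNonnegSelfAdjoint_adjoint_mul_closure hA hc
  have hx' : (m⁻¹ • x, (0 : H)) ∈ A.closure.graph := by
    have := A.closure.graph.smul_mem m⁻¹ hx
    rwa [Prod.smul_mk, smul_zero] at this
  have h1 : R x = m⁻¹ • x := by
    refine hG.eq_of_mem_graph hm (h.mem_graph x)
      (mem_graph_opMul.2 ⟨0, hx', A†.graph.zero_mem⟩) ?_
    rw [smul_smul, mul_inv_cancel₀ hm.ne', one_smul]
    abel
  refine ⟨by rw [h1, smul_smul, mul_inv_cancel₀ hm.ne', one_smul], ?_⟩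
  exact A.closure.mem_graph_snd_inj (h.mem_closure x) hx' h1

end IsResolventPair

/-- The closure of `(m + A* cl(A))⁻¹ (-A*)` is the bounded operator `-K*`. -/
theorem opEval_closure_resolvent_mul_adjoint {A : H →ₗ.[ℝ] H} {m : ℝ} {R K : H →L[ℝ] H}
    (hRK : IsResolventPair A m R K) (hA : Dense (A.domain : Set H)) (hc : A.IsClosable)
    (hA' : Dense (A†.domain : Set H)) (hm : 0 < m) (y z : H) :
    ⟪opEval (opMul ((m • (LinearMap.id : H →ₗ[ℝ] H)) +ᵥ opMul A† A.closure).inverse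
      (-A†)).closure y, z⟫_ℝ = -⟪y, K z⟫_ℝ := by
  have hG := isNonnegSelfAdjoint_adjoint_mul_closure hA hc
  set G := opMul A† A.closure
  set N := (m • (LinearMap.id : H →ₗ[ℝ] H)) +ᵥ G with hN
  have hNG : ∀ x w, (x, w) ∈ N.graph ↔ (x, w - m • x) ∈ G.graph := by
    intro x w
    simp only [LinearPMap.mem_graph_iff, hN, LinearPMap.vadd_apply, LinearPMap.vadd_domain]
    constructor
    · rintro ⟨v, rfl, rfl⟩
      exact ⟨v, rfl, by simp⟩
    · rintro ⟨v, rfl, hv⟩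
      exact ⟨v, rfl, by simp [hv]⟩
  have hker : LinearMap.ker N.toFun = ⊥ := by
    rw [LinearMap.ker_eq_bot']
    intro v hv
    have h1 : ((v : H), (0 : H)) ∈ N.graph := N.mem_graph_iff.2 ⟨v, rfl, hv⟩
    rw [hNG, zero_sub] at h1
    exact Subtype.ext (hG.eq_zero_of_mem_graph hm h1)
  have hinv : ∀ w x, (w, x) ∈ N.inverse.graph ↔ (x, w - m • x) ∈ G.graph := by
    intro w x
    rw [LinearPMap.inverse_graph hker, ← hNG]
    simp
  have hgraph : ∀ y u, (y, u) ∈ (opMul N.inverse (-A†)).graph ↔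
      ∃ w, (y, -w) ∈ A†.graph ∧ (u, w - m • u) ∈ G.graph := by
    intro y u
    simp only [mem_graph_opMul, mem_graph_neg, hinv]
  have hval := opEval_closure_of_le_clm (F := opMul N.inverse (-A†)) (S := -K.adjoint)
    (fun y u hyu => by
      obtain ⟨w, hyw, hu⟩ := (hgraph y u).1 hyu
      have hRu : u = R w := hG.eq_of_mem_graph hm hu (hRK.mem_graph w) (by abel)
      refine ext_inner_right ℝ fun g => ?_
      have h1 := hRK.inner_eq hA hc hyw g
      rw [neg_apply, inner_neg_left, ContinuousLinearMap.adjoint_inner_left,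
        h1, hRu, map_neg, inner_neg_left, neg_neg])
    (hA'.mono fun y hy => by
      obtain ⟨w, hw⟩ := LinearPMap.mem_domain_iff.1 hy
      exact LinearPMap.mem_domain_of_mem_graph
        ((hgraph y (R (-w))).2 ⟨-w, by rwa [neg_neg], hRK.mem_graph (-w)⟩)) y
  rw [hval, neg_apply, inner_neg_left, ContinuousLinearMap.adjoint_inner_left]

end Factor

/-! ### The abstract hypocoercivity setting -/

section Setting

variable {H : Type*} [NormedAddCommGroup H] [InnerProductSpace ℝ H]

/-- To prove a closed relation between `f` and `L f` for all `f` in the domain of `L`, it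
suffices to prove it on a core. -/
theorem graph_induction_of_hasCore {L : H →ₗ.[ℝ] H} {C : Submodule ℝ H} (hC : L.HasCore C)
    (hL : L.IsClosed) {p : H → H → Prop} (hp : IsClosed {x : H × H | p x.1 x.2})
    (h : ∀ f v, f ∈ C → (f, v) ∈ L.graph → p f v) {f v : H} (hf : (f, v) ∈ L.graph) : p f v := by
  have hc : (L.domRestrict C).IsClosable := hL.isClosable.leIsClosable LinearPMap.domRestrict_le
  have hle := LinearPMap.le_graph_of_le (LinearPMap.domRestrict_le : L.domRestrict C ≤ L)
  rw [← hC.closure_eq] at hf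
  obtain ⟨u, w, huw, hu, hw⟩ := (mem_graph_closure hc).1 hf
  refine hp.mem_of_tendsto (hu.prodMk_nhds hw) (Eventually.of_forall fun n => ?_)
  refine h _ _ ?_ (hle (huw n))
  have h1 := LinearPMap.mem_domain_of_mem_graph (huw n)
  exact (Submodule.mem_inf.1 h1).1

variable [CompleteSpace H]

section Parts

variable {L : H →ₗ.[ℝ] H} {C : Submodule ℝ H}

theorem inner_opEval_adjoint (hd : Dense (L.domain : Set H)) {f g : H} (hf : f ∈ L.domain)
    (hg : g ∈ L†.domain) : ⟪opEval L f, g⟫_ℝ = ⟪f, opEval L† g⟫_ℝ :=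
  (mem_graph_adjoint hd).1 (opEval_mem_graph hg) _ _ (opEval_mem_graph hf)

theorem mem_domain_symPart (hC : C ≤ L.domain ⊓ L†.domain) {f : H} :
    f ∈ (symPart L C).domain ↔ f ∈ C := by
  change f ∈ C ⊓ (L.domain ⊓ L†.domain) ↔ f ∈ C
  rw [inf_eq_left.2 hC]

theorem mem_domain_antisymPart (hC : C ≤ L.domain ⊓ L†.domain) {f : H} :
    f ∈ (antisymPart L C).domain ↔ f ∈ C := by
  change f ∈ C ⊓ (L.domain ⊓ L†.domain) ↔ f ∈ C
  rw [inf_eq_left.2 hC]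

theorem opEval_symPart (hC : C ≤ L.domain ⊓ L†.domain) {f : H} (hf : f ∈ C) :
    opEval (symPart L C) f = (1 / 2 : ℝ) • (opEval L f + opEval L† f) := by
  have hf' := hC hf
  rw [opEval, dif_pos ((mem_domain_symPart hC).2 hf), opEval,
    dif_pos (show f ∈ L.domain from hf'.1), opEval, dif_pos (show f ∈ L†.domain from hf'.2)]
  rfl

theorem opEval_antisymPart (hC : C ≤ L.domain ⊓ L†.domain) {f : H} (hf : f ∈ C) :
    opEval (antisymPart L C) f = (1 / 2 : ℝ) • (opEval L f - opEval L† f) := by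
  have hf' := hC hf
  rw [opEval, dif_pos ((mem_domain_antisymPart hC).2 hf), opEval,
    dif_pos (show f ∈ L.domain from hf'.1), opEval, dif_pos (show f ∈ L†.domain from hf'.2)]
  rfl

theorem antisymPart_add_symPart (hC : C ≤ L.domain ⊓ L†.domain) {f : H} (hf : f ∈ C) :
    opEval (antisymPart L C) f + opEval (symPart L C) f = opEval L f := by
  rw [opEval_symPart hC hf, opEval_antisymPart hC hf]
  module

theorem inner_symPart (hd : Dense (L.domain : Set H)) (hC : C ≤ L.domain ⊓ L†.domain) {f g : H}
    (hf : f ∈ C) (hg : g ∈ C) :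
    ⟪opEval (symPart L C) f, g⟫_ℝ = ⟪f, opEval (symPart L C) g⟫_ℝ := by
  rw [opEval_symPart hC hf, opEval_symPart hC hg]
  simp only [inner_smul_left, inner_smul_right, inner_add_left, inner_add_right,
    RCLike.conj_to_real]
  rw [inner_opEval_adjoint hd (hC hf).1 (hC hg).2, real_inner_comm g (opEval L† f),
    ← inner_opEval_adjoint hd (hC hg).1 (hC hf).2, real_inner_comm f]
  ring

theorem inner_antisymPart (hd : Dense (L.domain : Set H)) (hC : C ≤ L.domain ⊓ L†.domain)
    {f g : H} (hf : f ∈ C) (hg : g ∈ C) :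
    ⟪opEval (antisymPart L C) f, g⟫_ℝ = -⟪f, opEval (antisymPart L C) g⟫_ℝ := by
  rw [opEval_antisymPart hC hf, opEval_antisymPart hC hg]
  simp only [inner_smul_left, inner_smul_right, inner_sub_left, inner_sub_right,
    RCLike.conj_to_real]
  rw [inner_opEval_adjoint hd (hC hf).1 (hC hg).2, real_inner_comm g (opEval L† f),
    ← inner_opEval_adjoint hd (hC hg).1 (hC hf).2, real_inner_comm f]
  ring

end Parts

/-- The assumptions on the semigroup `P`, its generator `L`, the core `C`, the orthogonal
projection `Pr` and the unit vector `e` (the constant function `1`), in an abstract Hilbert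
space: `R₀` is the constant of the remainder condition for the operator
`(m + G)⁻¹ (-(T Π))*`, and `C_P` that of the strong Poincaré inequality. The functional `Ψ` and
the weak Poincaré inequality are not part of it. -/
structure HypocoercivitySetting (L : H →ₗ.[ℝ] H) (P : ℝ≥0 → H →L[ℝ] H) (C : Submodule ℝ H)
    (Pr : H →ₗ[ℝ] H) (e : H) (m R₀ C_P : ℝ) : Prop where
  closed : L.IsClosed
  semigroup : IsContractionSemigroup P
  generator : IsGeneratorOf L P
  core : L.HasCore C
  dense : Dense (C : Set H)
  le_domain : C ≤ L.domain ⊓ L†.domain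
  proj_symm : ∀ f g, ⟪Pr f, g⟫_ℝ = ⟪f, Pr g⟫_ℝ
  proj_idem : ∀ f, Pr (Pr f) = Pr f
  proj_mem : ∀ f ∈ C, Pr f ∈ C
  range_le_ker : ∀ f, (Pr f, 0) ∈ (symPart L C)†.graph
  proj_T_proj : ∀ f ∈ C, Pr (opEval (opTPi L C Pr) f) = 0
  remainder : ∀ f ∈ C, |⟪opEval (opA L C Pr m).closure
        (opEval (antisymPart L C) (f - Pr f)), f⟫_ℝ
      + ⟪opEval (opA L C Pr m).closure (opEval (symPart L C) f), f⟫_ℝ|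
    ≤ R₀ * ‖f - Pr f‖ * ‖Pr f‖
  poincare : ∀ f ∈ C, ‖f - Pr f‖ ^ 2 ≤ C_P * ⟪-opEval (symPart L C) f, f⟫_ℝ
  norm_e : ‖e‖ = 1
  proj_e : Pr e = e
  semigroup_e : ∀ t, P t e = e
  inner_e : ∀ t f, ⟪P t f, e⟫_ℝ = ⟪f, e⟫_ℝ
  m_pos : 0 < m
  one_le_R₀ : 1 ≤ R₀
  C_P_pos : 0 < C_P

namespace HypocoercivitySetting

variable {L : H →ₗ.[ℝ] H} {P : ℝ≥0 → H →L[ℝ] H} {C : Submodule ℝ H} {Pr : H →ₗ[ℝ] H} {e : H}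
  {m R₀ C_P : ℝ}

/-! ### The orthogonal projection -/

theorem norm_proj_le (h : HypocoercivitySetting L P C Pr e m R₀ C_P) (f : H) : ‖Pr f‖ ≤ ‖f‖ := by
  have h1 := real_inner_le_norm f (Pr f)
  rw [← h.proj_idem, ← h.proj_symm, real_inner_self_eq_norm_sq, h.proj_idem] at h1
  rcases (norm_nonneg (Pr f)).eq_or_lt with h0 | h0
  · rw [← h0]; exact norm_nonneg f
  · exact le_of_mul_le_mul_right (by nlinarith) h0

theorem continuous_proj (h : HypocoercivitySetting L P C Pr e m R₀ C_P) : Continuous Pr :=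
  (Pr.mkContinuous 1 fun f => by simpa using h.norm_proj_le f).continuous

theorem norm_sq_eq (h : HypocoercivitySetting L P C Pr e m R₀ C_P) (f : H) :
    ‖f‖ ^ 2 = ‖f - Pr f‖ ^ 2 + ‖Pr f‖ ^ 2 := by
  have h1 : ⟪f, Pr f⟫_ℝ = ‖Pr f‖ ^ 2 := by
    rw [← h.proj_idem, ← h.proj_symm, real_inner_self_eq_norm_sq, h.proj_idem]
  rw [norm_sub_sq_real, h1]
  ring

theorem proj_sub_proj (h : HypocoercivitySetting L P C Pr e m R₀ C_P) (f : H) :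
    Pr (f - Pr f) = 0 := by
  rw [map_sub, h.proj_idem, sub_self]

theorem inner_sub_proj (h : HypocoercivitySetting L P C Pr e m R₀ C_P) {f g : H}
    (hg : Pr g = 0) : ⟪f, g⟫_ℝ = ⟪f - Pr f, g⟫_ℝ := by
  rw [inner_sub_left, h.proj_symm, hg, inner_zero_right, sub_zero]

/-! ### The operator `T Π` and its adjoint -/

theorem dense_domain (h : HypocoercivitySetting L P C Pr e m R₀ C_P) :
    Dense (L.domain : Set H) :=
  h.dense.mono fun _ hf => (h.le_domain hf).1

/-- The range of `S` is orthogonal to that of `Π`; this is `Ran Π ⊆ Ker S*`. -/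
theorem symPart_proj (h : HypocoercivitySetting L P C Pr e m R₀ C_P) {f : H} (hf : f ∈ C) (g : H) :
    ⟪opEval (symPart L C) f, Pr g⟫_ℝ = 0 := by
  have hd : Dense ((symPart L C).domain : Set H) :=
    h.dense.mono fun x hx => (mem_domain_symPart h.le_domain).2 hx
  have := (mem_graph_adjoint hd).1 (h.range_le_ker g) _ _
    (opEval_mem_graph ((mem_domain_symPart h.le_domain).2 hf))
  rwa [inner_zero_right] at this

theorem symPart_proj_eq_zero (h : HypocoercivitySetting L P C Pr e m R₀ C_P) {f : H} (hf : f ∈ C) :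
    opEval (symPart L C) (Pr f) = 0 := by
  refine h.dense.eq_zero_of_inner_left ℝ fun g hg => ?_
  rw [inner_symPart h.dense_domain h.le_domain (h.proj_mem f hf) hg, real_inner_comm,
    h.symPart_proj hg]

/-- On `Π C` the generator `L` coincides with its antisymmetric part. -/
theorem opEval_proj (h : HypocoercivitySetting L P C Pr e m R₀ C_P) {f : H} (hf : f ∈ C) :
    opEval L (Pr f) = opEval (antisymPart L C) (Pr f) := by
  rw [← antisymPart_add_symPart h.le_domain (h.proj_mem f hf), h.symPart_proj_eq_zero hf, add_zero]

theorem mem_graph_TPi (h : HypocoercivitySetting L P C Pr e m R₀ C_P) {f g : H} :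
    (f, g) ∈ (opTPi L C Pr).graph ↔ Pr f ∈ C ∧ g = opEval (antisymPart L C) (Pr f) := by
  rw [opTPi, mem_graph_opMul]
  constructor
  · rintro ⟨y, hy, hyg⟩
    obtain ⟨x, rfl, rfl⟩ := (LinearPMap.mem_graph_iff _).1 hy
    exact ⟨(mem_domain_antisymPart h.le_domain).1 (LinearPMap.mem_domain_of_mem_graph hyg),
      (opEval_of_mem_graph hyg).symm⟩
  · rintro ⟨hf, rfl⟩
    exact ⟨Pr f, (LinearPMap.mem_graph_iff _).2 ⟨⟨f, Submodule.mem_top⟩, rfl, rfl⟩,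
      opEval_mem_graph ((mem_domain_antisymPart h.le_domain).2 hf)⟩

theorem dense_TPi (h : HypocoercivitySetting L P C Pr e m R₀ C_P) :
    Dense ((opTPi L C Pr).domain : Set H) :=
  h.dense.mono fun f hf =>
    LinearPMap.mem_domain_of_mem_graph (h.mem_graph_TPi.2 ⟨h.proj_mem f hf, rfl⟩)

theorem mem_graph_adjoint_TPi (h : HypocoercivitySetting L P C Pr e m R₀ C_P) {f : H}
    (hf : f ∈ C) : (f, -Pr (opEval (antisymPart L C) f)) ∈ (opTPi L C Pr)†.graph := by
  rw [mem_graph_adjoint h.dense_TPi]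
  intro x y hxy
  obtain ⟨hx, rfl⟩ := h.mem_graph_TPi.1 hxy
  rw [inner_antisymPart h.dense_domain h.le_domain hx hf, inner_neg_right, h.proj_symm]

theorem dense_adjoint_TPi (h : HypocoercivitySetting L P C Pr e m R₀ C_P) :
    Dense ((opTPi L C Pr)†.domain : Set H) :=
  h.dense.mono fun _ hf => LinearPMap.mem_domain_of_mem_graph (h.mem_graph_adjoint_TPi hf)

theorem isClosable_TPi (h : HypocoercivitySetting L P C Pr e m R₀ C_P) :
    (opTPi L C Pr).IsClosable :=
  isClosable_of_dense_adjoint h.dense_TPi h.dense_adjoint_TPi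

theorem mem_closure_TPi_of_proj_eq_zero (h : HypocoercivitySetting L P C Pr e m R₀ C_P) {x : H}
    (hx : Pr x = 0) : (x, 0) ∈ (opTPi L C Pr).closure.graph := by
  refine LinearPMap.le_graph_of_le (LinearPMap.le_closure _) (h.mem_graph_TPi.2 ?_)
  rw [hx]
  refine ⟨C.zero_mem, (opEval_of_mem_graph ?_).symm⟩
  exact (antisymPart L C).graph.zero_mem

theorem proj_closure_TPi (h : HypocoercivitySetting L P C Pr e m R₀ C_P) {x y : H}
    (hxy : (x, y) ∈ (opTPi L C Pr).closure.graph) : Pr y = 0 := by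
  obtain ⟨u, v, huv, -, hv⟩ := (mem_graph_closure h.isClosable_TPi).1 hxy
  refine tendsto_nhds_unique ((h.continuous_proj.tendsto y).comp hv)
    (tendsto_const_nhds.congr fun n => ?_)
  obtain ⟨hu, hvn⟩ := h.mem_graph_TPi.1 (huv n)
  have h1 := h.proj_T_proj _ hu
  rw [opEval_of_mem_graph (h.mem_graph_TPi.2 ⟨h.proj_mem _ hu, rfl⟩), h.proj_idem, ← hvn] at h1
  exact h1.symm

theorem proj_adjoint_TPi (h : HypocoercivitySetting L P C Pr e m R₀ C_P) {z w : H}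
    (hzw : (z, w) ∈ (opTPi L C Pr)†.graph) : Pr w = w := by
  refine h.dense_TPi.eq_of_inner_right ℝ fun x hx => ?_
  obtain ⟨y, hy⟩ := LinearPMap.mem_domain_iff.1 hx
  obtain ⟨hxC, rfl⟩ := h.mem_graph_TPi.1 hy
  rw [← h.proj_symm]
  rw [← (mem_graph_adjoint h.dense_TPi).1 hzw _ _ hy]
  refine ((mem_graph_adjoint h.dense_TPi).1 hzw _ _ (h.mem_graph_TPi.2 ⟨?_, ?_⟩)).symm
  · rwa [h.proj_idem]
  · rw [h.proj_idem]

/-! ### The operators `R`, `K` and the correction term -/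

variable {R K : H →L[ℝ] H}

theorem proj_K (h : HypocoercivitySetting L P C Pr e m R₀ C_P)
    (hRK : IsResolventPair (opTPi L C Pr) m R K) (g : H) : Pr (K g) = 0 :=
  h.proj_closure_TPi (hRK.mem_closure g)

theorem proj_sub_smul_R (h : HypocoercivitySetting L P C Pr e m R₀ C_P)
    (hRK : IsResolventPair (opTPi L C Pr) m R K) (g : H) : Pr (g - m • R g) = g - m • R g :=
  h.proj_adjoint_TPi (hRK.mem_adjoint g)

theorem proj_R (h : HypocoercivitySetting L P C Pr e m R₀ C_P)
    (hRK : IsResolventPair (opTPi L C Pr) m R K) {g : H} (hg : Pr g = g) : Pr (R g) = R g := by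
  have h1 := h.proj_sub_smul_R hRK g
  rw [map_sub, map_smul, hg, sub_right_inj] at h1
  exact smul_right_injective H h.m_pos.ne' h1

theorem K_proj (h : HypocoercivitySetting L P C Pr e m R₀ C_P)
    (hRK : IsResolventPair (opTPi L C Pr) m R K) (g : H) : K (Pr g) = K g := by
  have h1 := (hRK.of_mem_ker h.dense_TPi h.isClosable_TPi h.m_pos
    (h.mem_closure_TPi_of_proj_eq_zero (h.proj_sub_proj g))).2
  rw [map_sub, sub_eq_zero] at h1
  exact h1.symm

theorem sub_smul_R_proj (h : HypocoercivitySetting L P C Pr e m R₀ C_P)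
    (hRK : IsResolventPair (opTPi L C Pr) m R K) (g : H) :
    Pr g - m • R (Pr g) = g - m • R g := by
  have h1 := (hRK.of_mem_ker h.dense_TPi h.isClosable_TPi h.m_pos
    (h.mem_closure_TPi_of_proj_eq_zero (h.proj_sub_proj g))).1
  rw [map_sub, smul_sub] at h1
  rw [← sub_eq_zero, ← sub_eq_zero.2 h1]
  abel

/-- The remainder condition in bilinear form. As the two components of an element of the core can be
chosen independently, the bound on the quadratic form is one on a bilinear form. -/
theorem abs_inner_sub_le (h : HypocoercivitySetting L P C Pr e m R₀ C_P)
    (hRK : IsResolventPair (opTPi L C Pr) m R K) {f v : H} (hf : (f, v) ∈ L.graph) (g : H) :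
    |⟪v, K g⟫_ℝ - ⟪f, g - m • R g⟫_ℝ| ≤ R₀ * ‖f - Pr f‖ * ‖Pr g‖ := by
  have hPc := h.continuous_proj
  refine graph_induction_of_hasCore h.core h.closed
    (p := fun f v => |⟪v, K g⟫_ℝ - ⟪f, g - m • R g⟫_ℝ|
    ≤ R₀ * ‖f - Pr f‖ * ‖Pr g‖) (isClosed_le (by fun_prop) (by fun_prop)) ?_ hf
  intro f v hfC hfv
  refine h.dense.induction (P := fun g => |⟪v, K g⟫_ℝ - ⟪f, g - m • R g⟫_ℝ|
    ≤ R₀ * ‖f - Pr f‖ * ‖Pr g‖) ?_ (isClosed_le (by fun_prop) (by fun_prop)) g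
  intro g hg
  set q := f - Pr f with hq
  set p := Pr g with hp
  have hpC : p ∈ C := h.proj_mem g hg
  have hqC : q ∈ C := C.sub_mem hfC (h.proj_mem f hfC)
  have hPrq : Pr q = 0 := h.proj_sub_proj f
  have hPrp : Pr p = p := h.proj_idem g
  have hPr : Pr (q + p) = p := by rw [map_add, hPrq, hPrp, zero_add]
  have hKF : K (q + p) = K g := by rw [← h.K_proj hRK (q + p), hPr, hp, h.K_proj hRK]
  have hSF : opEval (symPart L C) (q + p) = opEval (symPart L C) q := by
    have h1 := (symPart L C).graph.add_mem
      (opEval_mem_graph ((mem_domain_symPart h.le_domain).2 hqC))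
      (opEval_mem_graph ((mem_domain_symPart h.le_domain).2 hpC))
    rw [Prod.mk_add_mk] at h1
    rw [opEval_of_mem_graph h1, hp, h.symPart_proj_eq_zero hg, add_zero]
  have hrem := h.remainder (q + p) (C.add_mem hqC hpC)
  rw [hPr, add_sub_cancel_right, hSF, opA, opG] at hrem
  simp only [opEval_closure_resolvent_mul_adjoint hRK h.dense_TPi h.isClosable_TPi
    h.dense_adjoint_TPi h.m_pos] at hrem
  rw [hKF, ← neg_add, abs_neg, ← inner_add_left, antisymPart_add_symPart h.le_domain hqC] at hrem
  have hLf : v = opEval (antisymPart L C) (Pr f) + opEval L q := by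
    rw [← h.opEval_proj hfC]
    have h1 := L.graph.add_mem (opEval_mem_graph (h.le_domain (h.proj_mem f hfC)).1)
      (opEval_mem_graph (h.le_domain hqC).1)
    rw [Prod.mk_add_mk] at h1
    exact L.mem_graph_snd_inj hfv h1 (by rw [hq]; abel)
  have hTPi := (mem_graph_adjoint h.dense_TPi).1 (hRK.mem_adjoint g) _ _
    (h.mem_graph_TPi.2 ⟨h.proj_mem f hfC, rfl⟩)
  rw [hLf, inner_add_left, hTPi, add_sub_cancel_left]
  exact hrem

/-- A lower bound for the part `⟪f, K L f⟫` of the derivative of `⟪f, K f⟫`. On the core,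
`K* f = R w` with `w = -Π T f` lies in the range of `Π`, so that only `T` contributes, and
`⟪f, K L f⟫ = -⟪R w, w⟫ = -⟪f, K w⟫` with `‖K w‖² ≤ ⟪R w, w⟫`. -/
theorem neg_norm_sq_le_inner (h : HypocoercivitySetting L P C Pr e m R₀ C_P)
    (hRK : IsResolventPair (opTPi L C Pr) m R K) {f v : H} (hf : (f, v) ∈ L.graph) :
    -‖f - Pr f‖ ^ 2 ≤ ⟪f, K v⟫_ℝ := by
  have hPc := h.continuous_proj
  refine graph_induction_of_hasCore h.core h.closed
    (p := fun f v => -‖f - Pr f‖ ^ 2 ≤ ⟪f, K v⟫_ℝ)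
    (isClosed_le (by fun_prop) (by fun_prop)) ?_ hf
  intro f v hfC hfv
  have hA := h.mem_graph_adjoint_TPi hfC
  set w := -Pr (opEval (antisymPart L C) f) with hw
  have hRw : Pr (R w) = R w := h.proj_R hRK (h.proj_adjoint_TPi hA)
  have hv : v = opEval (antisymPart L C) f + opEval (symPart L C) f := by
    rw [antisymPart_add_symPart h.le_domain hfC]
    exact (opEval_of_mem_graph hfv).symm
  have h1 : ⟪f, K v⟫_ℝ = -⟪R w, w⟫_ℝ := by
    rw [hRK.inner_eq h.dense_TPi h.isClosable_TPi hA, hv, inner_add_right,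
      ← hRw, real_inner_comm (opEval (symPart L C) f), h.symPart_proj hfC, add_zero, h.proj_symm,
      hw, inner_neg_right, neg_neg, hRw]
  have h2 : ⟪R w, w⟫_ℝ ≤ ‖f - Pr f‖ * ‖K w‖ := by
    rw [← hRK.inner_eq h.dense_TPi h.isClosable_TPi hA, h.inner_sub_proj (h.proj_K hRK w)]
    exact real_inner_le_norm _ _
  have h3 : ‖K w‖ ^ 2 ≤ ⟪R w, w⟫_ℝ := by
    rw [hRK.norm_sq_eq h.dense_TPi h.isClosable_TPi]
    have := mul_nonneg h.m_pos.le (sq_nonneg ‖R w‖)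
    linarith
  rw [h1]
  nlinarith [sq_nonneg (‖f - Pr f‖ - ‖K w‖)]

theorem norm_sub_proj_sq_le (h : HypocoercivitySetting L P C Pr e m R₀ C_P) {f v : H}
    (hf : (f, v) ∈ L.graph) : ‖f - Pr f‖ ^ 2 ≤ C_P * (-⟪v, f⟫_ℝ) := by
  have hPc := h.continuous_proj
  refine graph_induction_of_hasCore h.core h.closed
    (p := fun f v => ‖f - Pr f‖ ^ 2 ≤ C_P * (-⟪v, f⟫_ℝ))
    (isClosed_le (by fun_prop) (by fun_prop)) ?_ hf
  intro f v hfC hfv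
  have h1 := h.poincare f hfC
  have h2 := inner_antisymPart h.dense_domain h.le_domain hfC hfC
  have h2' := real_inner_comm f (opEval (antisymPart L C) f)
  have h3 : ⟪v, f⟫_ℝ = ⟪opEval (symPart L C) f, f⟫_ℝ := by
    rw [← opEval_of_mem_graph hfv, ← antisymPart_add_symPart h.le_domain hfC, inner_add_left]
    linarith
  rwa [inner_neg_left, ← h3] at h1

/-- The operator `K` is bounded by `R₀ C_P`, whatever the size of `C_P`. Formally, `K g` lies in the
domain of `L*`, the coercivity of `-L*` bounds `‖K g‖² / C_P` by `-⟪L* K g, K g⟫`, and the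
bilinear form of the remainder condition bounds the latter by `R₀ ‖Π g‖ ‖K g‖`. The adjoint is
avoided by testing with `n (n - L)⁻¹ K g`, which tends to `K g`. -/
theorem norm_K_le (h : HypocoercivitySetting L P C Pr e m R₀ C_P)
    (hRK : IsResolventPair (opTPi L C Pr) m R K) (g : H) : ‖K g‖ ≤ R₀ * C_P * ‖Pr g‖ := by
  have hPc := h.continuous_proj
  set k := K g with hk
  have hPk : Pr k = 0 := h.proj_K hRK g
  have hn : ∀ n : ℕ, (0 : ℝ) < (n : ℝ) + 1 := fun n => by positivity
  choose u v huv hsum using fun n : ℕ => h.generator.exists_resolvent h.semigroup h.closed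
    h.dense_domain (hn n) (((n : ℝ) + 1) • k)
  have hv : ∀ n, v n = ((n : ℝ) + 1) • (u n - k) := fun n => by
    rw [smul_sub, ← hsum n, sub_sub_cancel]
  -- `n (n - L)⁻¹` tends strongly to the identity
  have hbound : ∀ n (x y : H), (x, y) ∈ L.graph →
      ‖u n - k‖ ≤ 2 * ‖k - x‖ + ‖y‖ * (1 / ((n : ℝ) + 1)) := by
    intro n x y hxy
    have h1 := h.generator.inner_nonpos h.semigroup (L.graph.sub_mem (huv n) hxy)
    have h2 : v n - y = ((n : ℝ) + 1) • (u n - x) - (((n : ℝ) + 1) • (k - x) + y) := by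
      rw [hv]; module
    rw [h2, inner_sub_left, inner_smul_left, RCLike.conj_to_real,
      real_inner_self_eq_norm_sq] at h1
    have h3 := real_inner_le_norm (((n : ℝ) + 1) • (k - x) + y) (u n - x)
    have h4 : ‖((n : ℝ) + 1) • (k - x) + y‖ ≤ ((n : ℝ) + 1) * ‖k - x‖ + ‖y‖ := by
      refine (norm_add_le _ _).trans ?_
      rw [norm_smul, Real.norm_of_nonneg (hn n).le]
    have h5 : ‖u n - x‖ ≤ ‖k - x‖ + ‖y‖ * (1 / ((n : ℝ) + 1)) := by
      have h6 : ((n : ℝ) + 1) * ‖u n - x‖ ≤ ((n : ℝ) + 1) * ‖k - x‖ + ‖y‖ := by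
        rcases (norm_nonneg (u n - x)).eq_or_lt with h0 | h0
        · rw [← h0, mul_zero]
          have := (hn n).le
          positivity
        · refine le_of_mul_le_mul_right ?_ h0
          have := mul_le_mul_of_nonneg_right h4 h0.le
          nlinarith
      have h7 : ‖k - x‖ + ‖y‖ * (1 / ((n : ℝ) + 1))
          = (((n : ℝ) + 1) * ‖k - x‖ + ‖y‖) / ((n : ℝ) + 1) := by
        have := (hn n).ne'
        field_simp
      rw [h7, le_div_iff₀ (hn n)]
      linarith
    have h8 : ‖u n - k‖ ≤ ‖u n - x‖ + ‖k - x‖ := by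
      rw [← sub_sub_sub_cancel_right (u n) k x]
      exact norm_sub_le _ _
    linarith
  have hu : Tendsto u atTop (𝓝 k) := by
    rw [Metric.tendsto_atTop]
    intro ε hε
    obtain ⟨x, hx, hd⟩ := h.dense_domain.exists_dist_lt k (show 0 < ε / 4 by positivity)
    obtain ⟨y, hy⟩ := LinearPMap.mem_domain_iff.1 hx
    have h0 : Tendsto (fun n : ℕ => ‖y‖ * (1 / ((n : ℝ) + 1))) atTop (𝓝 0) := by
      simpa using (tendsto_one_div_add_atTop_nhds_zero_nat (𝕜 := ℝ)).const_mul ‖y‖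
    obtain ⟨N, hN⟩ := eventually_atTop.1 (h0.eventually (gt_mem_nhds (half_pos hε)))
    refine ⟨N, fun n hnN => ?_⟩
    rw [dist_eq_norm] at hd ⊢
    linarith [hbound n x y hy, hN n hnN]
  have hineq : ∀ n, ‖u n - Pr (u n)‖ ^ 2
      ≤ C_P * (R₀ * ‖u n - Pr (u n)‖ * ‖Pr g‖ - ⟪u n, g - m • R g⟫_ℝ) := by
    intro n
    refine (h.norm_sub_proj_sq_le (huv n)).trans (mul_le_mul_of_nonneg_left ?_ h.C_P_pos.le)
    have h1 := (abs_le.1 (h.abs_inner_sub_le hRK (huv n) g)).1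
    have h2 : ⟪v n, u n⟫_ℝ = ⟪v n, k⟫_ℝ + ((n : ℝ) + 1) * ‖u n - k‖ ^ 2 := by
      have h3 : ⟪v n, u n - k⟫_ℝ = ((n : ℝ) + 1) * ‖u n - k‖ ^ 2 := by
        rw [hv, inner_smul_left, RCLike.conj_to_real, real_inner_self_eq_norm_sq]
      rw [← h3, inner_sub_right]
      ring
    have h3 := mul_nonneg (hn n).le (sq_nonneg ‖u n - k‖)
    linarith
  have hq : Tendsto (fun n => ‖u n - Pr (u n)‖) atTop (𝓝 ‖k‖) := by
    have h1 := (hu.sub ((hPc.tendsto k).comp hu)).norm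
    rwa [hPk, sub_zero] at h1
  have horth : ⟪k, g - m • R g⟫_ℝ = 0 := by
    rw [← h.proj_sub_smul_R hRK, ← h.proj_symm, hPk, inner_zero_left]
  have hr : Tendsto (fun n => ⟪u n, g - m • R g⟫_ℝ) atTop (𝓝 0) := by
    rw [← horth]
    exact hu.inner tendsto_const_nhds
  have hlim := le_of_tendsto_of_tendsto' (hq.pow 2)
    ((((hq.const_mul R₀).mul_const ‖Pr g‖).sub hr).const_mul C_P) hineq
  rcases (norm_nonneg k).eq_or_lt with h0 | h0
  · rw [← h0]
    have := h.C_P_pos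
    have := h.one_le_R₀
    positivity
  · refine le_of_mul_le_mul_right ?_ h0
    nlinarith

end HypocoercivitySetting

end Setting

/-! ### Decay in the abstract setting -/

section Decay

variable {H : Type*} [NormedAddCommGroup H] [InnerProductSpace ℝ H]

theorem IsGeneratorOf.apply_eq_self {P : ℝ≥0 → H →L[ℝ] H} {L : H →ₗ.[ℝ] H}
    (hL : IsGeneratorOf L P) (hP : IsContractionSemigroup P) {f : H} (hf : (f, 0) ∈ L.graph)
    (t : ℝ≥0) : P t f = f := by
  have h := constant_of_has_deriv_right_zero (f := fun s : ℝ => P s.toNNReal f) (a := 0) (b := t)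
    (hP.continuous_toNNReal f).continuousOn
    (fun s hs => by simpa using hL.hasDerivWithinAt hP hf hs.1) t ⟨t.coe_nonneg, le_rfl⟩
  simpa [hP.apply_zero] using h

variable [CompleteSpace H]

namespace HypocoercivitySetting

variable {L : H →ₗ.[ℝ] H} {P : ℝ≥0 → H →L[ℝ] H} {C : Submodule ℝ H} {Pr : H →ₗ[ℝ] H} {e : H}
  {m R₀ C_P : ℝ} {R K : H →L[ℝ] H}

theorem inner_form_nonneg (h : HypocoercivitySetting L P C Pr e m R₀ C_P)
    (hRK : IsResolventPair (opTPi L C Pr) m R K) (f : H) : 0 ≤ ⟪f, f - m • R f⟫_ℝ := by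
  have := h.m_pos
  rw [hRK.inner_form_eq h.dense_TPi h.isClosable_TPi]
  positivity

theorem e_mem_graph (h : HypocoercivitySetting L P C Pr e m R₀ C_P) : (e, 0) ∈ L.graph := by
  rw [h.generator]
  simp [h.semigroup_e]

/-- The constants lie in the kernel of `G`. This is not assumed; it follows from the remainder
condition at the constant function, where `L` and `1 - Π` vanish. -/
theorem e_mem_graph_G (h : HypocoercivitySetting L P C Pr e m R₀ C_P)
    (hRK : IsResolventPair (opTPi L C Pr) m R K) : (e, 0) ∈ (opG L C Pr).graph := by
  have h1 := h.abs_inner_sub_le hRK h.e_mem_graph e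
  rw [h.proj_e, sub_self, norm_zero, mul_zero, zero_mul, inner_zero_left, zero_sub, abs_neg,
    hRK.inner_form_eq h.dense_TPi h.isClosable_TPi] at h1
  have h2 := (le_abs_self _).trans h1
  have h3 := mul_nonneg h.m_pos.le (sq_nonneg ‖K e‖)
  have h4 : ‖e - m • R e‖ ^ 2 = 0 := by nlinarith [sq_nonneg ‖e - m • R e‖]
  have h5 : e - m • R e = 0 := by simpa using h4
  have h6 := (opG L C Pr).graph.smul_mem m (hRK.mem_graph e)
  rwa [h5, Prod.smul_mk, smul_zero, ← sub_eq_zero.1 h5] at h6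

/-- The weak Poincaré inequality along the semigroup of `G` turns into one for the bounded form
`⟪f, G (m + G)⁻¹ f⟫`. -/
theorem norm_proj_sq_le (h : HypocoercivitySetting L P C Pr e m R₀ C_P)
    (hRK : IsResolventPair (opTPi L C Pr) m R K) {α M : ℝ} (hα : 1 ≤ α) {f : H}
    (hf : ∀ Q, IsContractionSemigroup Q → IsGeneratorOf (-opG L C Pr) Q → ∀ t y,
      (Q t (Pr f), y) ∈ (opTPi L C Pr).closure.graph →
      ‖Pr (Q t (Pr f)) - ⟪Q t (Pr f), e⟫_ℝ • e‖ ^ 2 ≤ α * ‖y‖ ^ 2 + M) :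
    ‖Pr (f - ⟪f, e⟫_ℝ • e)‖ ^ 2 ≤ (1 + m) * α *
      ⟪f - ⟪f, e⟫_ℝ • e, f - ⟪f, e⟫_ℝ • e - m • R (f - ⟪f, e⟫_ℝ • e)⟫_ℝ + M := by
  have hA := h.dense_TPi
  have hc := h.isClosable_TPi
  have hG : IsNonnegSelfAdjoint (opG L C Pr) := isNonnegSelfAdjoint_adjoint_mul_closure hA hc
  obtain ⟨Q, hQ, hgen, hsym, hdom⟩ := hG.exists_semigroup
  have he := h.e_mem_graph_G hRK
  have hfix : ∀ x, (x, (0 : H)) ∈ (opG L C Pr).graph → ∀ t, Q t x = x := fun x hx t =>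
    hgen.apply_eq_self hQ (mem_graph_neg.2 (by rwa [neg_zero])) t
  -- the semigroup of `G` preserves the range of the projection and the mean
  have hrange : ∀ t, Pr (Q t (Pr f)) = Q t (Pr f) := by
    intro t
    set z := Q t (Pr f)
    have h1 := hfix (z - Pr z) (mem_graph_opMul.2
      ⟨0, h.mem_closure_TPi_of_proj_eq_zero (h.proj_sub_proj z), LinearPMap.graph _ |>.zero_mem⟩) t
    have h2 : ⟪z, z - Pr z⟫_ℝ = 0 := by
      rw [hsym, h1, h.proj_symm, h.proj_sub_proj, inner_zero_right]
    rw [h.inner_sub_proj (h.proj_sub_proj z), real_inner_self_eq_norm_sq] at h2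
    have h3 : z - Pr z = 0 := by simpa using h2
    exact (sub_eq_zero.1 h3).symm
  have hmean : ∀ t, ⟪Q t (Pr f), e⟫_ℝ = ⟪f, e⟫_ℝ := fun t => by
    rw [hsym, hfix e he, h.proj_symm, h.proj_e]
  set c := ⟪f, e⟫_ℝ
  have hg : Pr (f - c • e) = Pr f - c • e := by rw [map_sub, map_smul, h.proj_e]
  have hQg : ∀ t, Q t (Pr (f - c • e)) = Q t (Pr f) - c • e := fun t => by
    rw [hg, map_sub, map_smul, hfix e he]
  have key := norm_sq_le_resolvent_form hQ hgen hsym hdom (zero_lt_one.trans_le hα) h.m_pos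
    (hRK.mem_graph (Pr (f - c • e))) (M := M) (fun t _ z hz => by
      rw [hQg] at hz ⊢
      have hz' : (Q t (Pr f), z) ∈ (opG L C Pr).graph := by
        have := (opG L C Pr).graph.add_mem hz ((opG L C Pr).graph.smul_mem c he)
        rwa [Prod.smul_mk, Prod.mk_add_mk, sub_add_cancel, smul_zero, add_zero] at this
      obtain ⟨y, hy, hyz⟩ := mem_graph_opMul.1 hz'
      have h1 := hf Q hQ hgen t y hy
      have h2 : ⟪z, Q t (Pr f) - c • e⟫_ℝ = ‖y‖ ^ 2 := by
        rw [inner_sub_right, inner_smul_right, hG.symm _ _ _ _ hz' he, inner_zero_right, mul_zero,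
          sub_zero, real_inner_comm, ← inner_closure_adjoint hA hc hy hyz,
          real_inner_self_eq_norm_sq]
      rwa [hrange, hmean, ← h2] at h1)
  rw [h.sub_smul_R_proj hRK, real_inner_comm, h.proj_symm, h.proj_sub_smul_R hRK] at key
  have hΛ := h.inner_form_nonneg hRK (f - c • e)
  have hm := h.m_pos
  refine key.trans (add_le_add_left (mul_le_mul_of_nonneg_right ?_ hΛ) M)
  nlinarith

/-- Exponential decay at a rate of order `α⁻²`, up to an error `M`. -/
theorem norm_sub_mean_sq_le (h : HypocoercivitySetting L P C Pr e m R₀ C_P) {α M : ℝ}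
    (hα : 1 ≤ α) (hM : 0 ≤ M) {f v : H} (hfv : (f, v) ∈ L.graph)
    (hf : ∀ s Q, IsContractionSemigroup Q → IsGeneratorOf (-opG L C Pr) Q → ∀ t y,
      (Q t (Pr (P s f)), y) ∈ (opTPi L C Pr).closure.graph →
      ‖Pr (Q t (Pr (P s f))) - ⟪Q t (Pr (P s f)), e⟫_ℝ • e‖ ^ 2 ≤ α * ‖y‖ ^ 2 + M) (t : ℝ≥0) :
    ‖P t f - ⟪f, e⟫_ℝ • e‖ ^ 2 ≤
      3 * Real.exp (-(1 / (R₀ ^ 2 * (2 + (√(m / 2))⁻¹) * (1 + m) ^ 2) / C_P * t / α ^ 2)) * ‖f‖ ^ 2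
        + 2 * (2 + (√(m / 2))⁻¹) * M := by
  have hm := h.m_pos
  have hR₀ : 0 < R₀ := zero_lt_one.trans_le h.one_le_R₀
  have hα0 : 0 < α := zero_lt_one.trans_le hα
  obtain ⟨R, K, hRK⟩ := exists_isResolventPair h.dense_TPi h.isClosable_TPi hm
  set s := (√(m / 2))⁻¹ with hs
  have hs0 : 0 < s := inv_pos.2 (Real.sqrt_pos.2 (by positivity))
  set θ := 1 / ((1 + m) * α) with hθ
  have hθ0 : 0 < θ := by positivity
  have hθm : θ ≤ 1 / (1 + m) := by
    refine one_div_le_one_div_of_le (by positivity) ?_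
    nlinarith
  have hθ1 : θ ≤ 1 := hθm.trans (by rw [div_le_one (by positivity)]; linarith)
  -- the summand `s` of the rate absorbs the cross term of the modified norm
  have hθs : θ ≤ s := by
    refine hθm.trans ?_
    rw [hs, ← one_div]
    refine one_div_le_one_div_of_le (Real.sqrt_pos.2 (by positivity)) ?_
    rw [Real.sqrt_le_left (by positivity)]
    nlinarith
  set lam := θ ^ 2 / (R₀ ^ 2 * (2 + s)) with hlam
  have hlam0 : 0 < lam := by positivity
  have hlamθ : lam * (2 + θ) ≤ θ ^ 2 / R₀ ^ 2 := by
    have h1 : lam * (2 + s) = θ ^ 2 / R₀ ^ 2 := by rw [hlam]; field_simp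
    rw [← h1]
    exact mul_le_mul_of_nonneg_left (by linarith) hlam0.le
  set c := ⟪f, e⟫_ℝ with hcdef
  have hf0 : (f - c • e, v) ∈ L.graph := by
    have := L.graph.sub_mem hfv (L.graph.smul_mem c h.e_mem_graph)
    rwa [Prod.smul_mk, smul_zero, Prod.mk_sub_mk, sub_zero] at this
  have hPf0 : ∀ s, P s (f - c • e) = P s f - ⟪P s f, e⟫_ℝ • e := fun s => by
    rw [map_sub, map_smul, h.semigroup_e, h.inner_e]
  have key := norm_sq_le_of_lyapunov h.semigroup h.generator (p := Pr) (K := K)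
    (Λ := fun u => ⟪u, u - m • R u⟫_ℝ) hf0 h.one_le_R₀ h.C_P_pos hθ0 hθ1 hlam0 hlamθ hM
    h.norm_sq_eq (fun u v => h.norm_sub_proj_sq_le)
    (fun u v huv => by
      have h1 := (abs_le.1 (h.abs_inner_sub_le hRK huv u)).1
      have h2 := h.neg_norm_sq_le_inner hRK huv
      linarith)
    (fun u => by
      rw [h.inner_sub_proj (h.proj_K hRK u)]
      refine (abs_real_inner_le_norm _ _).trans ?_
      have := mul_le_mul_of_nonneg_left (h.norm_K_le hRK u) (norm_nonneg (u - Pr u))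
      linarith)
    (fun s => by
      have h1 := h.norm_proj_sq_le hRK hα (hf s)
      rw [← hPf0] at h1
      have h2 := mul_le_mul_of_nonneg_left h1 hθ0.le
      have h3 : θ * ((1 + m) * α) = 1 := by rw [hθ]; field_simp
      rwa [mul_add, ← mul_assoc, h3, one_mul] at h2) t
  have hnorm : ‖f - c • e‖ ^ 2 ≤ ‖f‖ ^ 2 := by
    have h1 : ‖f - c • e‖ ^ 2 = ‖f‖ ^ 2 - c ^ 2 := by
      rw [norm_sub_sq_real, inner_smul_right, norm_smul, h.norm_e, ← hcdef, mul_one,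
        Real.norm_eq_abs, sq_abs]
      ring
    nlinarith [sq_nonneg c]
  have hexp : lam / C_P * t
      = 1 / (R₀ ^ 2 * (2 + s) * (1 + m) ^ 2) / C_P * t / α ^ 2 := by
    have := h.C_P_pos
    rw [hlam, hθ]
    field_simp
  have hcoef : 2 * θ ^ 2 / (R₀ ^ 2 * lam) = 2 * (2 + s) := by
    rw [hlam]
    field_simp
  rw [hexp, hcoef, hPf0, h.inner_e] at key
  refine key.trans (add_le_add_left (mul_le_mul_of_nonneg_left hnorm ?_) _)
  positivity

end HypocoercivitySetting

end Decay

/-! ### The velocity average and the rate function -/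

section Mean

variable {E : Type*} [MeasurableSpace E] (μ : Measure E) [IsProbabilityMeasure μ]

theorem inner_const_one (f : Lp ℝ 2 μ) : ⟪f, Lp.const 2 μ (1 : ℝ)⟫_ℝ = ∫ z, f z ∂μ := by
  rw [L2.inner_def]
  refine integral_congr_ae ?_
  filter_upwards [Lp.coeFn_const (p := 2) (μ := μ) (1 : ℝ)] with z hz
  rw [hz]
  simp

theorem meanFun_eq (f : Lp ℝ 2 μ) :
    meanFun μ f = ⟪f, Lp.const 2 μ (1 : ℝ)⟫_ℝ • Lp.const 2 μ (1 : ℝ) := by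
  rw [inner_const_one, meanFun]
  have := (Lp.constₗ 2 μ ℝ (E := ℝ)).map_smul (∫ z, f z ∂μ) 1
  simpa using this

theorem norm_const_one : ‖Lp.const 2 μ (1 : ℝ)‖ = 1 := by
  have h1 := inner_const_one μ (Lp.const 2 μ (1 : ℝ))
  rw [integral_congr_ae (Lp.coeFn_const (p := 2) (μ := μ) (1 : ℝ)),
    real_inner_self_eq_norm_sq] at h1
  have h2 := norm_nonneg (Lp.const 2 μ (1 : ℝ))
  simp only [Function.const_apply, integral_const, probReal_univ, smul_eq_mul, mul_one] at h1
  nlinarith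

end Mean

section VelocityAverage

variable {X V : Type*} [MeasurableSpace X] [MeasurableSpace V] (π : Measure X) (ν : Measure V)
  [IsProbabilityMeasure π] [IsProbabilityMeasure ν]

theorem coeFn_velocityAverage (f : Lp ℝ 2 (π.prod ν)) :
    velocityAverage π ν f =ᵐ[π.prod ν] fun z => ∫ w, f (z.1, w) ∂ν :=
  MemLp.coeFn_toLp (memLp_velocityAverage π ν f)

theorem inner_velocityAverage_eq (f g : Lp ℝ 2 (π.prod ν)) :
    ⟪velocityAverage π ν f, g⟫_ℝ = ∫ x, (∫ w, f (x, w) ∂ν) * ∫ w, g (x, w) ∂ν ∂π := by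
  have h1 : ⟪velocityAverage π ν f, g⟫_ℝ
      = ∫ z : X × V, (∫ w, f (z.1, w) ∂ν) * g z ∂(π.prod ν) := by
    rw [L2.inner_def]
    refine integral_congr_ae ?_
    filter_upwards [coeFn_velocityAverage π ν f] with z hz
    rw [hz]
    simp [mul_comm]
  have hint : Integrable (fun z : X × V => (∫ w, f (z.1, w) ∂ν) * g z) (π.prod ν) :=
    (memLp_velocityAverage π ν f).integrable_mul (Lp.memLp g)
  rw [h1, integral_prod _ hint]
  exact integral_congr_ae (Eventually.of_forall fun x =>
    integral_const_mul (∫ w, f (x, w) ∂ν) fun w => g (x, w))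

theorem velocityAverage_symm (f g : Lp ℝ 2 (π.prod ν)) :
    ⟪velocityAverage π ν f, g⟫_ℝ = ⟪f, velocityAverage π ν g⟫_ℝ := by
  rw [real_inner_comm (velocityAverage π ν g) f, inner_velocityAverage_eq, inner_velocityAverage_eq]
  simp only [mul_comm]

/-- Functions which depend on the position only are fixed by the velocity average. -/
theorem velocityAverage_eq_self {f : Lp ℝ 2 (π.prod ν)} {F : X → ℝ}
    (hf : f =ᵐ[π.prod ν] fun z => F z.1) : velocityAverage π ν f = f := by
  refine Lp.ext ((coeFn_velocityAverage π ν f).trans (EventuallyEq.trans ?_ hf.symm))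
  have h : ∀ᵐ x ∂π, ∫ w, f (x, w) ∂ν = F x := by
    filter_upwards [Measure.ae_ae_of_ae_prod hf] with x hx
    rw [integral_congr_ae hx]
    simp
  exact (Measure.quasiMeasurePreserving_fst (μ := π) (ν := ν)).ae h

end VelocityAverage

section Conclusion

variable {X V : Type*} [MeasurableSpace X] [MeasurableSpace V]
  {π : Measure X} {ν : Measure V} [IsProbabilityMeasure π] [IsProbabilityMeasure ν]
  {L : Lp ℝ 2 (π.prod ν) →ₗ.[ℝ] Lp ℝ 2 (π.prod ν)}
  {P : ℝ≥0 → Lp ℝ 2 (π.prod ν) →L[ℝ] Lp ℝ 2 (π.prod ν)}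
  {C : Submodule ℝ (Lp ℝ 2 (π.prod ν))} {Ψ : Lp ℝ 2 (π.prod ν) → ℝ≥0∞} {α : ℝ → ℝ}
  {m R₀ C_P : ℝ}

theorem hypocoercivitySetting_of_conditions (hB : BasicCondition π ν L P C)
    (hI : CoreInvariance π ν C) (hPr : ProjectionCondition π ν L C)
    (hR : RemainderCondition π ν L C m R₀) (hS : StrongPoincare π ν L C C_P)
    (hm : 0 < m) (hR₀ : 1 ≤ R₀) (hC : 0 < C_P) :
    HypocoercivitySetting L P C (velocityAverage π ν) (Lp.const 2 (π.prod ν) (1 : ℝ)) m R₀ C_P where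
  closed := hB.closed
  semigroup := hB.semigroup
  generator := hB.generator
  core := hB.core
  dense := hB.dense
  le_domain := hB.le_domain
  proj_symm := velocityAverage_symm π ν
  proj_idem f := velocityAverage_eq_self π ν (F := fun x => ∫ w, f (x, w) ∂ν)
    (coeFn_velocityAverage π ν f)
  proj_mem := hI
  range_le_ker := hPr.range_le_ker
  proj_T_proj := hPr.proj_T_proj
  remainder := hR
  poincare := hS
  norm_e := norm_const_one _
  proj_e := velocityAverage_eq_self π ν (F := fun _ => 1) (Lp.coeFn_const _ _ _)
  semigroup_e t := by
    -- stationarity is `P_t* 1 = 1`, and a contraction has the same fixed points as its adjoint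
    have h1 := inner_const_one (π.prod ν) (P t (Lp.const 2 (π.prod ν) (1 : ℝ)))
    rw [hB.stationary, ← inner_const_one, real_inner_self_eq_norm_sq, norm_const_one] at h1
    have h2 := hB.semigroup.norm_apply_le t (Lp.const 2 (π.prod ν) (1 : ℝ))
    rw [norm_const_one] at h2
    have h3 := norm_sub_sq_real (P t (Lp.const 2 (π.prod ν) (1 : ℝ)))
      (Lp.const 2 (π.prod ν) (1 : ℝ))
    rw [h1, norm_const_one] at h3
    have h4 : ‖P t (Lp.const 2 (π.prod ν) (1 : ℝ)) - Lp.const 2 (π.prod ν) (1 : ℝ)‖ ^ 2 ≤ 0 := by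
      rw [h3]
      nlinarith [norm_nonneg (P t (Lp.const 2 (π.prod ν) (1 : ℝ)))]
    have h5 := le_antisymm h4 (sq_nonneg _)
    exact sub_eq_zero.1 (norm_eq_zero.1 (pow_eq_zero_iff two_ne_zero |>.1 h5))
  inner_e t f := by rw [inner_const_one, inner_const_one, hB.stationary]
  m_pos := hm
  one_le_R₀ := hR₀
  C_P_pos := hC

/-- Decay for initial values in the domain of `L`. Applying `e^{-tG} Π P_s` does not increase `Ψ`,
so that `r Ψ(f)` bounds the error term of all the weak Poincaré inequalities involved. -/
theorem norm_sub_meanFun_sq_le_of_mem_domain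
    (h : HypocoercivitySetting L P C (velocityAverage π ν) (Lp.const 2 (π.prod ν) (1 : ℝ)) m R₀ C_P)
    (hΨ : PsiCondition π ν L P C Ψ) (hα : ∀ r : ℝ, 0 < r → 1 ≤ α r)
    (hW : WeakPoincare π ν L C Ψ α) {f : Lp ℝ 2 (π.prod ν)} (hf : f ∈ L.domain) (hfin : Ψ f < ∞)
    {r : ℝ} (hr : 0 < r) (t : ℝ≥0) :
    ‖P t f - meanFun (π.prod ν) f‖ ^ 2 ≤
      3 * Real.exp (-(1 / (R₀ ^ 2 * (2 + (√(m / 2))⁻¹) * (1 + m) ^ 2) / C_P * t / α r ^ 2))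
        * ‖f‖ ^ 2 + 2 * (2 + (√(m / 2))⁻¹) * (r * (Ψ f).toReal) := by
  obtain ⟨v, hv⟩ := LinearPMap.mem_domain_iff.1 hf
  rw [meanFun_eq]
  refine h.norm_sub_mean_sq_le (hα r hr) (by positivity) hv (fun s Q hQ hgen t y hy => ?_) t
  set x := Q t (velocityAverage π ν (P s f)) with hx
  have hmem := LinearPMap.mem_domain_of_mem_graph hy
  have hval : (opTPi L C (velocityAverage π ν)).closure ⟨x, hmem⟩ = y :=
    LinearPMap.mem_graph_snd_inj _ (LinearPMap.mem_graph _ ⟨x, hmem⟩) hy rfl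
  have h1 := hW ⟨x, hmem⟩ r hr
  rw [hval, meanFun_eq] at h1
  have h2 : Ψ (velocityAverage π ν x) ≤ Ψ f :=
    (hΨ.proj_le x).trans <| (hΨ.heat_le Q hQ hgen t _).trans <|
      (hΨ.proj_le _).trans (hΨ.semigroup_le s f)
  have hα0 : 0 ≤ α r := zero_le_one.trans (hα r hr)
  have h3 : ENNReal.ofReal (α r * ‖y‖ ^ 2) + ENNReal.ofReal r * Ψ (velocityAverage π ν x)
      ≤ ENNReal.ofReal (α r * ‖y‖ ^ 2 + r * (Ψ f).toReal) := by
    rw [ENNReal.ofReal_add (by positivity) (by positivity), ENNReal.ofReal_mul hr.le,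
      ENNReal.ofReal_toReal hfin.ne]
    gcongr
  exact (ENNReal.ofReal_le_ofReal_iff (by positivity)).1 (h1.trans h3)

theorem norm_sub_meanFun_sq_le
    (h : HypocoercivitySetting L P C (velocityAverage π ν) (Lp.const 2 (π.prod ν) (1 : ℝ)) m R₀ C_P)
    (hΨ : PsiCondition π ν L P C Ψ) (hα : ∀ r : ℝ, 0 < r → 1 ≤ α r)
    (hW : WeakPoincare π ν L C Ψ α) (hA : PsiApproximation π ν L Ψ) {f : Lp ℝ 2 (π.prod ν)}
    (hfin : Ψ f < ∞) {r : ℝ} (hr : 0 < r) (t : ℝ≥0) :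
    ‖P t f - meanFun (π.prod ν) f‖ ^ 2 ≤
      3 * Real.exp (-(1 / (R₀ ^ 2 * (2 + (√(m / 2))⁻¹) * (1 + m) ^ 2) / C_P * t / α r ^ 2))
        * ‖f‖ ^ 2 + 2 * (2 + (√(m / 2))⁻¹) * (r * (Ψ f).toReal) := by
  obtain ⟨u, hu, hlim, hsup⟩ := hA f hfin
  set q := 2 * (2 + (√(m / 2))⁻¹) with hq
  have hq0 : 0 < q := by positivity
  refine le_of_forall_pos_le_add fun ε hε => ?_
  set δ := ε / (q * r) with hδ
  have hδ0 : 0 < δ := by positivity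
  have hlt : limsup (fun n => Ψ (u n)) atTop < Ψ f + ENNReal.ofReal δ :=
    hsup.trans_lt (ENNReal.lt_add_right hfin.ne (by simpa using hδ0))
  have hev := eventually_lt_of_limsup_lt hlt
  have hl : Tendsto (fun n => ‖P t (u n) - meanFun (π.prod ν) (u n)‖ ^ 2) atTop
      (𝓝 (‖P t f - meanFun (π.prod ν) f‖ ^ 2)) := by
    simp only [meanFun_eq]
    have h1 : Continuous fun g : Lp ℝ 2 (π.prod ν) => ‖P t g
      - ⟪g, Lp.const 2 (π.prod ν) (1 : ℝ)⟫_ℝ • Lp.const 2 (π.prod ν) (1 : ℝ)‖ ^ 2 := by fun_prop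
    exact (h1.tendsto f).comp hlim
  set E := Real.exp (-(1 / (R₀ ^ 2 * (2 + (√(m / 2))⁻¹) * (1 + m) ^ 2) / C_P * t / α r ^ 2))
  have hrhs : Tendsto (fun n => 3 * E * ‖u n‖ ^ 2 + q * (r * ((Ψ f).toReal + δ))) atTop
      (𝓝 (3 * E * ‖f‖ ^ 2 + q * (r * ((Ψ f).toReal + δ)))) :=
    ((hlim.norm.pow 2).const_mul _).add_const _
  have hfin2 := le_of_tendsto_of_tendsto hl hrhs (by
    filter_upwards [hev] with n hn
    have hn' : Ψ (u n) < ∞ := hn.trans_le le_top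
    have h1 := norm_sub_meanFun_sq_le_of_mem_domain h hΨ hα hW (hu n) hn' hr t
    refine h1.trans (add_le_add_right (mul_le_mul_of_nonneg_left
      (mul_le_mul_of_nonneg_left ?_ hr.le) hq0.le) _)
    have h2 := ENNReal.toReal_mono (by simp [hfin.ne]) hn.le
    rwa [ENNReal.toReal_add hfin.ne ENNReal.ofReal_ne_top, ENNReal.toReal_ofReal hδ0.le] at h2)
  have h3 : q * (r * ((Ψ f).toReal + δ)) = q * (r * (Ψ f).toReal) + ε := by
    rw [hδ]
    field_simp
  linarith

end Conclusion

theorem corollary2 (m₂ R₀ : ℝ) (hm₂ : 0 < m₂) (hR₀ : 1 ≤ R₀) :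
    ∃ c₁ c₂ : ℝ, 0 < c₁ ∧ 0 < c₂ ∧
      (1 ≤ m₂ → c₂ = 1 / (R₀ ^ 2 * (2 + (Real.sqrt (m₂ / 2))⁻¹) * (1 + m₂) ^ 2)) ∧
      ∀ (d : ℕ) [NeZero d]
        (V : Set (EuclideanSpace ℝ (Fin d))) (_ : IsClosed V)
        (π : Measure (EuclideanSpace ℝ (Fin d))) (ν : Measure V)
        [IsProbabilityMeasure π] [IsProbabilityMeasure ν]
        (_ : Integrable (fun v : V => (v : EuclideanSpace ℝ (Fin d)) 0 ^ 2) ν)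
        (_ : ∫ v : V, (v : EuclideanSpace ℝ (Fin d)) 0 ^ 2 ∂ν = m₂)
        (L : Lp ℝ 2 (π.prod ν) →ₗ.[ℝ] Lp ℝ 2 (π.prod ν))
        (P : ℝ≥0 → Lp ℝ 2 (π.prod ν) →L[ℝ] Lp ℝ 2 (π.prod ν))
        (C : Submodule ℝ (Lp ℝ 2 (π.prod ν)))
        (Ψ : Lp ℝ 2 (π.prod ν) → ℝ≥0∞) (α₁ : ℝ → ℝ) (C_P : ℝ)
        (_ : BasicCondition π ν L P C)
        (_ : CoreInvariance π ν C)
        (_ : ProjectionCondition π ν L C)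
        (_ : RemainderCondition π ν L C m₂ R₀)
        (_ : PsiCondition π ν L P C Ψ)
        (_ : AntitoneOn α₁ (Set.Ioi 0)) (_ : ∀ r : ℝ, 0 < r → 1 ≤ α₁ r)
        (_ : WeakPoincare π ν L C Ψ α₁)
        (_ : 0 < C_P) (_ : StrongPoincare π ν L C C_P)
        (_ : PsiApproximation π ν L Ψ)
        (t : ℝ≥0) (f : Lp ℝ 2 (π.prod ν)),
        ENNReal.ofReal (‖P t f - meanFun (π.prod ν) f‖ ^ 2)
          ≤ ENNReal.ofReal (rateFun c₁ (c₂ / C_P) α₁ t)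
            * (ENNReal.ofReal (‖f‖ ^ 2) + Ψ f) := by
  have hR : 0 < R₀ := zero_lt_one.trans_le hR₀
  set s := (√(m₂ / 2))⁻¹ with hs
  have hs0 : 0 ≤ s := by positivity
  refine ⟨2 * (2 + s), 1 / (R₀ ^ 2 * (2 + s) * (1 + m₂) ^ 2), by positivity, by positivity,
    fun _ => rfl, ?_⟩
  intro d _ V _ π ν _ _ _ _ L P C Ψ α C_P hB hI hPr hRem hΨ _ hα hW hC hS hA t f
  have h := hypocoercivitySetting_of_conditions hB hI hPr hRem hS hm₂ hR₀ hC
  set c := 1 / (R₀ ^ 2 * (2 + s) * (1 + m₂) ^ 2) / C_P with hc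
  have hc0 : 0 < c := by positivity
  have hct : 0 ≤ c * t := mul_nonneg hc0.le t.coe_nonneg
  set S := {r : ℝ | 0 < r ∧ c * t ≥ α r ^ 2 * Real.log (1 / r)} with hS_def
  have hexp : ∀ r ∈ S, Real.exp (-(c * t / α r ^ 2)) ≤ r := by
    rintro r ⟨hr, hrS⟩
    have hα0 : 0 < α r := zero_lt_one.trans_le (hα r hr)
    rw [← Real.le_log_iff_exp_le hr, neg_le, ← Real.log_inv, ← one_div,
      le_div_iff₀ (by positivity), mul_comm]
    exact hrS
  have h1S : (1 : ℝ) ∈ S := ⟨one_pos, by simpa using hct⟩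
  -- the infimum is positive, as `α ≥ 1`; this matters where `Ψ f = ∞`
  have hinf : Real.exp (-(c * t)) ≤ sInf S := by
    refine le_csInf ⟨1, h1S⟩ fun r hrS => le_trans (Real.exp_le_exp.2 (neg_le_neg ?_)) (hexp r hrS)
    exact div_le_self hct (one_le_pow₀ (hα r hrS.1))
  have hinf0 : 0 < sInf S := (Real.exp_pos _).trans_le hinf
  have hrate : rateFun (2 * (2 + s)) c α t = 2 * (2 + s) * sInf S := rfl
  rw [hrate]
  rcases eq_or_ne (Ψ f) ∞ with htop | hfin
  · rw [htop, add_top, ENNReal.mul_top]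
    · exact le_top
    · rw [Ne, ENNReal.ofReal_eq_zero, not_le]
      positivity
  set Y := ‖f‖ ^ 2 + (Ψ f).toReal with hY
  have hY0 : 0 ≤ Y := by positivity
  have hbound : ∀ r ∈ S, ‖P t f - meanFun (π.prod ν) f‖ ^ 2 ≤ 2 * (2 + s) * Y * r := by
    intro r hrS
    have h1 := norm_sub_meanFun_sq_le h hΨ hα hW hA (lt_top_iff_ne_top.2 hfin) hrS.1 t
    have h2 := mul_le_mul_of_nonneg_right (hexp r hrS) (sq_nonneg ‖f‖)
    have h3 : 3 * (r * ‖f‖ ^ 2) ≤ 2 * (2 + s) * (r * ‖f‖ ^ 2) :=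
      mul_le_mul_of_nonneg_right (by linarith) (mul_nonneg hrS.1.le (sq_nonneg _))
    have h4 : 2 * (2 + s) * Y * r
        = 2 * (2 + s) * (r * ‖f‖ ^ 2) + 2 * (2 + s) * (r * (Ψ f).toReal) := by
      rw [hY]; ring
    rw [h4]
    linarith
  have hfinal : ‖P t f - meanFun (π.prod ν) f‖ ^ 2 ≤ 2 * (2 + s) * sInf S * Y := by
    rcases hY0.eq_or_lt with h0 | h0
    · have := hbound 1 h1S
      rw [← h0] at this ⊢
      linarith
    · have hpos : 0 < 2 * (2 + s) * Y := by positivity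
      have := le_csInf ⟨1, h1S⟩ fun r hrS => (div_le_iff₀' hpos).2 (hbound r hrS)
      rw [div_le_iff₀' hpos] at this
      linarith
  calc ENNReal.ofReal (‖P t f - meanFun (π.prod ν) f‖ ^ 2)
      ≤ ENNReal.ofReal (2 * (2 + s) * sInf S * Y) := ENNReal.ofReal_le_ofReal hfinal
    _ = ENNReal.ofReal (2 * (2 + s) * sInf S) * (ENNReal.ofReal (‖f‖ ^ 2) + Ψ f) := by
      rw [ENNReal.ofReal_mul (by positivity), hY, ENNReal.ofReal_add (by positivity)
        ENNReal.toReal_nonneg, ENNReal.ofReal_toReal hfin]
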